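/- An \emph{active tile} is a unit square $t=(G,L,\delta,\Pi)$. Each of its four sides carries a set of distinct glues, and it carries labels; every glue and every label is in one of the states latent, on, off ($G$ and $L$). The transition function $\delta$ assigns to each side $d$ and glue $g$ a finite set of actions ("turn glue $g'$ on side $d'$ on/off", "turn label $x$ on/off"), and $\Pi$ is the multiset of pending actions. A \emph{supertile} is a placement of active tiles on positions of $\mathbb{Z}^2$. Two equal glues on abutting sides of adjacent tiles, both on, are \emph{bound}; a supertile is $\tau$-stable if every cut of its binding graph has total strength at least $\tau$. Whenever two glues become bound, the actions that $\delta$ assigns to them are added to $\Pi$ for both tiles. An \emph{STAM system} $(T,\tau)$ has a finite set $T$ of initial supertiles with nothing pending and no glue off, and an integer temperature $\tau\ge 1$. Its transitions are: combining two $\tau$-stable supertiles (after a translation, without overlap) that bind to each other with total strength at least $\tau$; breaking a supertile along a cut of strength less than $\tau$; executing one pending glue or label action (the only effective state changes are latent$\to$on, latent$\to$off, on$\to$off). A supertile is \emph{finitely producible} if it arises from $T$ by finitely many transitions. It is \emph{producible} if it is nonempty and is the positionwise eventual limit of a finite or infinite sequence of supertiles that starts with a finitely producible one and in which each supertile arises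 from the previous one by one transition, where combinations are with finitely producible supertiles. It is \emph{terminal} if it is producible and no transition applies to it (a combination being one with any producible supertile). The system \emph{weakly self-assembles} $Y\subseteq\mathbb{Z}^2$ if terminal supertiles exist and there is a set $X$ of labels such that in every terminal supertile the set of positions of tiles with a label from $X$ in the state on is a translate of $Y$. The \emph{signal complexity} is the maximum number of glues on a face of a tile of $T$. Let $V=\{(1,0),(0,1)\}$, $S_0=\{(0,0)\}$, $S_{i+1}=S_i\cup(S_i+2^iV)$, and let $S_\triangle=\bigcup_{i\ge0}S_i$ be the discrete Sierpinski triangle. \textbf{Theorem.} There is an STAM system at temperature $\tau=1$, whose initial supertiles are exactly 5 distinct single tiles, all of whose glues have strength $1$, with signal complexity exactly $4$, in which no transition function ever requests that a glue be turned off (no glue deactivation), and which weakly self-assembles $S_\triangle$. -/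

import Mathlib

/-! The Signal-passing Tile Assembly Model (STAM) and the discrete Sierpinski triangle. -/

namespace STAM

/-- The four sides of a unit square tile. -/
inductive Dir where
  | north
  | south
  | east
  | west
  deriving DecidableEq

instance : Fintype Dir where
  elems := {.north, .south, .east, .west}
  complete := fun d => by cases d <;> decide

/-- The opposite side. -/
def Dir.opp : Dir → Dir
  | .north => .south
  | .south => .north
  | .east => .west
  | .west => .east

/-- The unit vector pointing out of a given side. -/
def Dir.vec : Dir → ℤ × ℤ
  | .north => (0, 1)
  | .south => (0, -1)
  | .east => (1, 0)
  | .west => (-1, 0)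

/-- The possible states of a glue (or of a label). -/
inductive State where
  | latent
  | on
  | off
  deriving DecidableEq

/-- The two states that an action can request. -/
inductive Target where
  | on
  | off
  deriving DecidableEq

/-- The effect of executing a request. The valid transitions are `latent → on`, `latent → off` and
`on → off`; every other request leaves the state unchanged. -/
def State.act : State → Target → State
  | .latent, .on => .on
  | .latent, .off => .off
  | .on, .off => .off
  | .on, .on => .on
  | .off, _ => .off

/-- Glue actions and label actions, over glue types `Γ` and labels `Λ`. -/
inductive Action (Γ Λ : Type) where
  | glue (d : Dir) (g : Γ) (q : Target)
  | label (x : Λ) (q : Target)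

/-- An active tile `(G, L, δ, Π)`. As a side carries at most one copy of each glue type, `G` is
recorded as the partial function sending a side and a glue type to the current state of that glue;
`none` means that the glue is absent. The same holds for the labels. -/
structure Tile (Γ Λ : Type) where
  glue : Dir → Γ → Option State
  label : Λ → Option State
  trans : Dir → Γ → Finset (Action Γ Λ)
  pending : Multiset (Action Γ Λ)

/-- A (possibly infinite) positioning of active tiles on the integer lattice. -/
abbrev Supertile (Γ Λ : Type) := ℤ × ℤ → Option (Tile Γ Λ)

variable {Γ Λ : Type}

/-- Add actions to the pending multiset of a tile. -/
def Tile.addPending (t : Tile Γ Λ) (M : Multiset (Action Γ Λ)) : Tile Γ Λ :=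
  { t with pending := t.pending + M }

/-- Change the state of the glue `g` on side `d`. -/
def Tile.setGlue [DecidableEq Γ] (t : Tile Γ Λ) (d : Dir) (g : Γ) (s : State) : Tile Γ Λ :=
  { t with glue := Function.update t.glue d (Function.update (t.glue d) g (some s)) }

/-- Change the state of the label `x`. -/
def Tile.setLabel [DecidableEq Λ] (t : Tile Γ Λ) (x : Λ) (s : State) : Tile Γ Λ :=
  { t with label := Function.update t.label x (some s) }

namespace Supertile

/-- The set of tiled positions. -/
def support (A : Supertile Γ Λ) : Set (ℤ × ℤ) := {p | A p ≠ none}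

/-- The supertile consisting of one tile, at the origin. -/
def single (t : Tile Γ Λ) : Supertile Γ Λ := fun p => if p = 0 then some t else none

/-- `A` translated by `v`. -/
def translate (v : ℤ × ℤ) (A : Supertile Γ Λ) : Supertile Γ Λ := fun p => A (p - v)

open Classical in
/-- The part of `A` lying in `X`. -/
noncomputable def restrict (A : Supertile Γ Λ) (X : Set (ℤ × ℤ)) : Supertile Γ Λ :=
  fun p => if p ∈ X then A p else none

/-- The state of the glue `g` on side `d` of the tile at `p`, if there is one. -/
def glueAt (A : Supertile Γ Λ) (p : ℤ × ℤ) (d : Dir) (g : Γ) : Option State :=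
  (A p).bind fun t => t.glue d g

/-- The glue `g` on side `d` of the tile of `A` at `p` and the same glue on the abutting side of a
tile of `B` are both on, so that they bind. -/
abbrev Bond (A B : Supertile Γ Λ) (p : ℤ × ℤ) (d : Dir) (g : Γ) : Prop :=
  A.glueAt p d g = some State.on ∧ B.glueAt (p + d.vec) d.opp g = some State.on

/-- The bonds from `A` to `B` have total strength at least `n`. (Strengths are natural numbers, so
a possibly infinite total is at least `n` iff some finite part of it is.) -/
def BondStrengthGE (strength : Γ → ℕ) (A B : Supertile Γ Λ) (n : ℕ) : Prop :=
  ∃ F : Finset ((ℤ × ℤ) × Dir × Γ),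
    (∀ e ∈ F, Bond A B e.1 e.2.1 e.2.2) ∧ n ≤ ∑ e ∈ F, strength e.2.2

/-- The partition of the tiles of `A` into those inside and those outside `X` is a cut of strength
less than `τ`. -/
def WeakCut (strength : Γ → ℕ) (τ : ℕ) (A : Supertile Γ Λ) (X : Set (ℤ × ℤ)) : Prop :=
  (A.restrict X).support.Nonempty ∧ (A.restrict Xᶜ).support.Nonempty ∧
    ¬ BondStrengthGE strength (A.restrict X) (A.restrict Xᶜ) τ

/-- Every cut of the binding graph of `A` has strength at least `τ`. -/
def Stable (strength : Γ → ℕ) (τ : ℕ) (A : Supertile Γ Λ) : Prop :=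
  ∀ X, ¬ WeakCut strength τ A X

/-- `A` and `B`, in their present positions, are `τ`-stable, do not overlap, and bind with total
strength at least `τ`. -/
def Combinable (strength : Γ → ℕ) (τ : ℕ) (A B : Supertile Γ Λ) : Prop :=
  Stable strength τ A ∧ Stable strength τ B ∧ Disjoint A.support B.support ∧
    BondStrengthGE strength A B τ

/-- `A` after all bonds from `A` to `B` have fired the transition functions of the tiles of `A`. -/
def fire [Fintype Γ] (A B : Supertile Γ Λ) : Supertile Γ Λ := fun p =>
  (A p).map fun t =>
    t.addPending (∑ d : Dir, ∑ g : Γ, if Bond A B p d g then (t.trans d g).val else 0)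

/-- The union of the disjoint supertiles `A` and `B`, in which all the bonds between `A` and `B`
have fired the transition functions of both tiles involved. -/
def combine [Fintype Γ] (A B : Supertile Γ Λ) : Supertile Γ Λ := fun p =>
  (A.fire B p).or (B.fire A p)

/-- Add actions to the pending multiset of the tile at `p`, if there is one. -/
def addPendingAt (A : Supertile Γ Λ) (p : ℤ × ℤ) (M : Multiset (Action Γ Λ)) : Supertile Γ Λ :=
  Function.update A p ((A p).map fun t => t.addPending M)

/-- The actions that the tile at `p` requests when its glue `g` on side `d` binds. -/
def transAt (A : Supertile Γ Λ) (p : ℤ × ℤ) (d : Dir) (g : Γ) : Multiset (Action Γ Λ) :=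
  (A p).elim 0 fun t => (t.trans d g).val

/-- If the glue `g` on side `d` of the tile at `p` is bound to the neighbouring tile, fire the
transition functions of both tiles for this bond. -/
def fireBond (A : Supertile Γ Λ) (p : ℤ × ℤ) (d : Dir) (g : Γ) : Supertile Γ Λ :=
  if Bond A A p d g then
    (A.addPendingAt p (A.transAt p d g)).addPendingAt (p + d.vec)
      (A.transAt (p + d.vec) d.opp g)
  else A

/-- `LocalStep strength τ A B`: a break, glue or label transition leads from `A` to `B`. -/
inductive LocalStep [DecidableEq Γ] [DecidableEq Λ] (strength : Γ → ℕ) (τ : ℕ) :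
    Supertile Γ Λ → Supertile Γ Λ → Prop
  /-- Break along a cut of strength less than `τ`. (The complement of `X` gives the same cut, so
  either of the two parts may be kept.) -/
  | break_apart (A : Supertile Γ Λ) (X : Set (ℤ × ℤ)) (hX : WeakCut strength τ A X) :
      LocalStep strength τ A (A.restrict X)
  /-- Execute a pending action on a glue that becomes on from latent. If an equal glue that is on
  abuts on it inside the supertile, then the two bind at once, which fires both transition
  functions. -/
  | glue_activate (A : Supertile Γ Λ) (p : ℤ × ℤ) (t : Tile Γ Λ) (d : Dir) (g : Γ)
      (rest : Multiset (Action Γ Λ)) (ht : A p = some t)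
      (hp : t.pending = Action.glue d g Target.on ::ₘ rest)
      (hs : t.glue d g = some State.latent) :
      LocalStep strength τ A
        (fireBond (Function.update A p
          (some { t.setGlue d g State.on with pending := rest })) p d g)
  /-- Execute any other pending action on a glue of the tile. -/
  | glue_other (A : Supertile Γ Λ) (p : ℤ × ℤ) (t : Tile Γ Λ) (d : Dir) (g : Γ) (q : Target)
      (s : State) (rest : Multiset (Action Γ Λ)) (ht : A p = some t)
      (hp : t.pending = Action.glue d g q ::ₘ rest)
      (hs : t.glue d g = some s) (hne : ¬ (s = State.latent ∧ q = Target.on)) :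
      LocalStep strength τ A
        (Function.update A p (some { t.setGlue d g (s.act q) with pending := rest }))
  /-- Execute a pending action on a label of the tile. -/
  | label (A : Supertile Γ Λ) (p : ℤ × ℤ) (t : Tile Γ Λ) (x : Λ) (q : Target)
      (s : State) (rest : Multiset (Action Γ Λ)) (ht : A p = some t)
      (hp : t.pending = Action.label x q ::ₘ rest) (hs : t.label x = some s) :
      LocalStep strength τ A
        (Function.update A p (some { t.setLabel x (s.act q) with pending := rest }))

end Supertile

open Supertile

/-- An STAM system: finitely many initial active supertiles, a positive temperature, and the
(positive) strength of each glue type. No action is pending initially, and no glue is initially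
off. -/
structure System (Γ Λ : Type) where
  strength : Γ → ℕ
  initial : Set (Supertile Γ Λ)
  temperature : ℕ
  strength_pos : ∀ g, 0 < strength g
  temperature_pos : 0 < temperature
  initial_finite : initial.Finite
  support_nonempty : ∀ A ∈ initial, A.support.Nonempty
  support_finite : ∀ A ∈ initial, A.support.Finite
  pending_empty : ∀ A ∈ initial, ∀ p t, A p = some t → t.pending = 0
  glue_ne_off : ∀ A ∈ initial, ∀ p t, A p = some t → ∀ d g, t.glue d g ≠ some State.off

namespace System

/-- The number of initial supertiles. -/
noncomputable def tileComplexity (S : System Γ Λ) : ℕ∞ := S.initial.encard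

/-- Every initial supertile is a single tile. -/
def HasSingletonTiles (S : System Γ Λ) : Prop :=
  ∀ A ∈ S.initial, ∃ t, A = single t

/-- The maximum number of glues (in any state) on a face of a tile of an initial supertile. -/
noncomputable def signalComplexity (S : System Γ Λ) : ℕ∞ :=
  ⨆ A ∈ S.initial, ⨆ (p : ℤ × ℤ), ⨆ (d : Dir), {g : Γ | A.glueAt p d g ≠ none}.encard

/-- No transition function ever requests that a glue be turned off. -/
def NoGlueDeactivation (S : System Γ Λ) : Prop :=
  ∀ A ∈ S.initial, ∀ p t, A p = some t →
    ∀ d g d' g', Action.glue d' g' Target.off ∉ t.trans d g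

section Dynamics

variable [Fintype Γ] [DecidableEq Γ] [DecidableEq Λ]

/-- The supertiles obtained from the initial ones by finitely many transitions. -/
inductive FinitelyProducible (S : System Γ Λ) : Supertile Γ Λ → Prop
  | base (A : Supertile Γ Λ) (hA : A ∈ S.initial) : FinitelyProducible S A
  | combination (A B : Supertile Γ Λ) (v : ℤ × ℤ) (hA : FinitelyProducible S A)
      (hB : FinitelyProducible S B)
      (h : Combinable S.strength S.temperature A (B.translate v)) :
      FinitelyProducible S (A.combine (B.translate v))
  | localStep (A B : Supertile Γ Λ) (hA : FinitelyProducible S A)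
      (h : LocalStep S.strength S.temperature A B) : FinitelyProducible S B

/-- One transition of the supertile `A`, which keeps its position in the plane: a break, glue or
label transition, or the combination with a translate of a finitely producible supertile. -/
def Step (S : System Γ Λ) (A A' : Supertile Γ Λ) : Prop :=
  LocalStep S.strength S.temperature A A' ∨
    ∃ (B : Supertile Γ Λ) (v : ℤ × ℤ), S.FinitelyProducible B ∧
      Combinable S.strength S.temperature A (B.translate v) ∧ A' = A.combine (B.translate v)

/-- An assembly sequence (a finite one is represented by a sequence that is finally constant). -/
def IsAssemblySequence (S : System Γ Λ) (α : ℕ → Supertile Γ Λ) : Prop :=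
  S.FinitelyProducible (α 0) ∧ ∀ n, α (n + 1) = α n ∨ S.Step (α n) (α (n + 1))

/-- The supertiles, finite or infinite, that result from an assembly sequence: at each position of
the plane, the sequence is finally constant, and the result has the final value there. -/
def Producible (S : System Γ Λ) (A : Supertile Γ Λ) : Prop :=
  A.support.Nonempty ∧ ∃ α, S.IsAssemblySequence α ∧ ∀ p, ∃ N, ∀ n ≥ N, α n p = A p

/-- A producible supertile for which no combination, break, glue or label transition is
possible. -/
def Terminal (S : System Γ Λ) (A : Supertile Γ Λ) : Prop :=
  S.Producible A ∧
    (∀ B v, S.Producible B → ¬ Combinable S.strength S.temperature A (B.translate v)) ∧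
    ∀ A', ¬ LocalStep S.strength S.temperature A A'

/-- The positions of the tiles that have some label from `X` in the state on. -/
def painted (X : Set Λ) (A : Supertile Γ Λ) : Set (ℤ × ℤ) :=
  {p | ∃ t, A p = some t ∧ ∃ x ∈ X, t.label x = some State.on}

/-- `S` weakly self-assembles the pattern `Y`: there are terminal supertiles, and for a suitable
set `X` of labels, the positions painted with a label from `X` in any terminal supertile are
exactly those in `Y`, up to a translation. -/
def WeaklySelfAssembles (S : System Γ Λ) (Y : Set (ℤ × ℤ)) : Prop :=
  (∃ A, S.Terminal A) ∧
    ∃ X : Set Λ, ∀ A, S.Terminal A → ∃ v : ℤ × ℤ, painted X A = (fun y => y + v) '' Y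

end Dynamics

end System

/-- The stages of the discrete Sierpinski triangle: `S₀ = {(0, 0)}` and
`Sᵢ₊₁ = Sᵢ ∪ (Sᵢ + 2 ^ i V)` with `V = {(1, 0), (0, 1)}`. -/
def sierpinskiStage : ℕ → Set (ℤ × ℤ)
  | 0 => {(0, 0)}
  | i + 1 => sierpinskiStage i ∪
      {p | ∃ m ∈ sierpinskiStage i, ∃ n ∈ ({(1, 0), (0, 1)} : Set (ℤ × ℤ)),
        p = m + (2 ^ i : ℤ) • n}

/-- The discrete Sierpinski triangle. -/
def sierpinski : Set (ℤ × ℤ) := ⋃ i, sierpinskiStage i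

end STAM

namespace STAM

/-! The tiles compute Pascal's triangle modulo 2. The value at `(x, y)` relative to the seed is the
parity of `(x + y).choose x`: it is 1 on both axes, and elsewhere it is the xor of the values to the
west and to the south. The positions of value 1 form the Sierpinski triangle (`mem_sierpinski`).

At temperature 1 a tile attaches by a single bond and cannot wait for two inputs. Signals make up
for this. An inner tile attaches by its western glue `w b` alone. That bond turns on southern glues
for both possible values of the tile below; only the correct one can bind, and its bond reveals the
southern value `a`. Only then are the label and the outputs `xor a b` to the east and to the north
requested. The order in which neighbours finish is therefore irrelevant.

The proof rests on two invariants. `Evolved` ties the state of a tile to its initial state and its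
present bonds: what has changed was requested by a bond, and what a bond requests is pending or
done. `Seeded` says that a supertile lies in the quadrant of a seed, has the prescribed kind at each
position, and that each other tile is bound to the one it attached to. Local steps
(`Seeded.localStep`), attachment of a tile (`Seeded.combine`) and limits (`Seeded.of_limit`)
preserve it, and two seeded supertiles never combine (`Seeded.not_combinable`). So a producible
supertile is seeded or a lone tile (`regular_of_producible`). A lone tile is not terminal
(`not_terminal_singleAt`). A terminal seeded supertile fills its quadrant with all signals executed
(`Seeded.output`), and its labels show the values (`Seeded.label_iff`). An explicit assembly
sequence gives a terminal supertile (`terminal_full`). -/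

/-! ### Bonds, cuts and combination at temperature 1. -/

theorem Dir.opp_opp (d : Dir) : d.opp.opp = d := by cases d <;> rfl

theorem Dir.vec_opp (d : Dir) : d.opp.vec = -d.vec := by cases d <;> rfl

theorem Dir.vec_ne_zero (d : Dir) : d.vec ≠ 0 := by cases d <;> decide

variable {Γ Λ : Type}

/-- The action requests the state on. -/
def Action.IsOn : Action Γ Λ → Prop
  | .glue _ _ q => q = .on
  | .label _ q => q = .on

/-- The glue or label that the action refers to is no longer latent. -/
def Tile.Done (t : Tile Γ Λ) : Action Γ Λ → Prop
  | .glue d g _ => t.glue d g ≠ some .latent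
  | .label x _ => t.label x ≠ some .latent

namespace Supertile

theorem bond_symm {A B : Supertile Γ Λ} {p : ℤ × ℤ} {d : Dir} {g : Γ} (h : Bond A B p d g) :
    Bond B A (p + d.vec) d.opp g := by
  refine ⟨h.2, ?_⟩
  rw [Dir.opp_opp, Dir.vec_opp, add_neg_cancel_right]
  exact h.1

theorem bondStrengthGE_one_iff {strength : Γ → ℕ} (hs : ∀ g, strength g = 1)
    {A B : Supertile Γ Λ} :
    BondStrengthGE strength A B 1 ↔ ∃ p d g, Bond A B p d g := by
  constructor
  · rintro ⟨F, hF, hn⟩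
    rcases F.eq_empty_or_nonempty with rfl | ⟨e, he⟩
    · simp at hn
    · exact ⟨_, _, _, hF e he⟩
  · rintro ⟨p, d, g, h⟩
    exact ⟨{(p, d, g)}, by simpa using h, by simp [hs]⟩

theorem combinable_symm {strength : Γ → ℕ} (hs : ∀ g, strength g = 1) {A B : Supertile Γ Λ}
    (h : Combinable strength 1 A B) : Combinable strength 1 B A := by
  obtain ⟨h1, h2, h3, h4⟩ := h
  rw [bondStrengthGE_one_iff hs] at h4
  obtain ⟨p, d, g, h4⟩ := h4
  exact ⟨h2, h1, h3.symm, (bondStrengthGE_one_iff hs).2 ⟨_, _, _, bond_symm h4⟩⟩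

theorem glueAt_eq_some {A : Supertile Γ Λ} {p : ℤ × ℤ} {d : Dir} {g : Γ} {s : State} :
    A.glueAt p d g = some s ↔ ∃ t, A p = some t ∧ t.glue d g = some s := by
  simp [glueAt, Option.bind_eq_some_iff]

theorem glueAt_of_eq {A : Supertile Γ Λ} {p : ℤ × ℤ} {t : Tile Γ Λ} (h : A p = some t) (d : Dir)
    (g : Γ) : A.glueAt p d g = t.glue d g := by
  simp [glueAt, h]

theorem glueAt_congr {A B : Supertile Γ Λ} {p : ℤ × ℤ} (h : A p = B p) (d : Dir) (g : Γ) :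
    A.glueAt p d g = B.glueAt p d g := by
  simp [glueAt, h]

theorem ne_none_of_glueAt {A : Supertile Γ Λ} {p : ℤ × ℤ} {d : Dir} {g : Γ} {s : State}
    (h : A.glueAt p d g = some s) : A p ≠ none := by
  obtain ⟨t, ht, -⟩ := glueAt_eq_some.1 h
  simp [ht]

theorem eq_none_of_disjoint {A B : Supertile Γ Λ} (h : Disjoint A.support B.support) {p : ℤ × ℤ}
    (hp : A p ≠ none) : B p = none := by
  by_contra hB
  exact Set.disjoint_left.1 h hp hB

/-- The actions that the bonds from `A` to `B` add to the tile `t` at `p`. -/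
def requested [Fintype Γ] (A B : Supertile Γ Λ) (p : ℤ × ℤ) (t : Tile Γ Λ) :
    Multiset (Action Γ Λ) :=
  ∑ d : Dir, ∑ g : Γ, if Bond A B p d g then (t.trans d g).val else 0

theorem mem_requested [Fintype Γ] {A B : Supertile Γ Λ} {p : ℤ × ℤ} {t : Tile Γ Λ}
    {a : Action Γ Λ} :
    a ∈ requested A B p t ↔ ∃ d g, Bond A B p d g ∧ a ∈ t.trans d g := by
  simp only [requested, Multiset.mem_sum, Finset.mem_univ, true_and]
  refine exists_congr fun d => exists_congr fun g => ?_
  split_ifs with h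
  · exact (and_iff_right h).symm
  · simp only [h, false_and, Multiset.notMem_zero]

theorem combine_of_left [Fintype Γ] {A B : Supertile Γ Λ} {p : ℤ × ℤ} {t : Tile Γ Λ}
    (h : A p = some t) : A.combine B p = some (t.addPending (requested A B p t)) := by
  simp [combine, fire, h, requested]

theorem combine_of_right [Fintype Γ] {A B : Supertile Γ Λ} {p : ℤ × ℤ} (h : A p = none) :
    A.combine B p = B.fire A p := by
  simp [combine, fire, h]

theorem combine_eq_none [Fintype Γ] {A B : Supertile Γ Λ} {p : ℤ × ℤ} :
    A.combine B p = none ↔ A p = none ∧ B p = none := by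
  simp [combine, fire]

theorem combine_comm [Fintype Γ] {A B : Supertile Γ Λ} (h : Disjoint A.support B.support) :
    A.combine B = B.combine A := by
  funext p
  by_cases hA : A p = none
  · rw [combine_of_right hA]
    simp [combine, fire, hA]
  · have hB := eq_none_of_disjoint h hA
    simp [combine, fire, hB]

theorem glueAt_combine [Fintype Γ] {A B : Supertile Γ Λ} (h : Disjoint A.support B.support)
    {p : ℤ × ℤ} {d : Dir} {g : Γ} {s : State} :
    (A.combine B).glueAt p d g = some s ↔
      A.glueAt p d g = some s ∨ B.glueAt p d g = some s := by
  by_cases hA : A p = none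
  · simp only [glueAt, combine_of_right hA, fire, hA]
    cases B p <;> simp [Tile.addPending]
  · have hB := eq_none_of_disjoint h hA
    obtain ⟨t, ht⟩ := Option.ne_none_iff_exists'.1 hA
    simp [glueAt, combine_of_left ht, ht, hB, Tile.addPending]

theorem bond_combine [Fintype Γ] {A B : Supertile Γ Λ} (h : Disjoint A.support B.support)
    {p : ℤ × ℤ} (hp : A p ≠ none) {d : Dir} {g : Γ} :
    Bond (A.combine B) (A.combine B) p d g ↔ Bond A A p d g ∨ Bond A B p d g := by
  have hB := eq_none_of_disjoint h hp
  simp only [Bond, glueAt_combine h]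
  have : B.glueAt p d g ≠ some .on := by simp [glueAt, hB]
  tauto

/-! ### Histories of tiles and their preservation under transitions. -/

/-- Some bond of the tile at `p`, whose initial state is `t₀`, requests the action `a`. -/
def Fired (A : Supertile Γ Λ) (p : ℤ × ℤ) (t₀ : Tile Γ Λ) (a : Action Γ Λ) : Prop :=
  ∃ d g, Bond A A p d g ∧ a ∈ t₀.trans d g

/-- The tile `t` at position `p` of `A` has evolved from the initial tile `t₀` through the execution
of actions requested by its bonds in `A`, and those not yet executed are pending. -/
structure Evolved (A : Supertile Γ Λ) (p : ℤ × ℤ) (t₀ t : Tile Γ Λ) : Prop where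
  trans_eq : t.trans = t₀.trans
  glue_eq : ∀ d g, t.glue d g = t₀.glue d g ∨
    t₀.glue d g = some .latent ∧ t.glue d g = some .on ∧ Fired A p t₀ (.glue d g .on)
  label_eq : ∀ x, t.label x = t₀.label x ∨
    t₀.label x = some .latent ∧ t.label x = some .on ∧ Fired A p t₀ (.label x .on)
  fired_of_pending : ∀ a ∈ t.pending, Fired A p t₀ a
  pending_or_done : ∀ a, Fired A p t₀ a → a ∈ t.pending ∨ t.Done a

theorem Fired.mono {A B : Supertile Γ Λ} {p : ℤ × ℤ} {t₀ : Tile Γ Λ} {a : Action Γ Λ}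
    (h : ∀ d g, Bond A A p d g → Bond B B p d g) (hf : Fired A p t₀ a) : Fired B p t₀ a := by
  obtain ⟨d, g, hb, ha⟩ := hf
  exact ⟨d, g, h d g hb, ha⟩

theorem Evolved.congr {A B : Supertile Γ Λ} {p : ℤ × ℤ} {t₀ t : Tile Γ Λ} (h : Evolved A p t₀ t)
    (hb : ∀ d g, Bond A A p d g ↔ Bond B B p d g) : Evolved B p t₀ t := by
  have : ∀ a, Fired A p t₀ a ↔ Fired B p t₀ a := fun a => by simp only [Fired, hb]
  exact ⟨h.trans_eq, by simpa only [this] using h.glue_eq, by simpa only [this] using h.label_eq,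
    by simpa only [this] using h.fired_of_pending, by simpa only [this] using h.pending_or_done⟩

/-- New bonds add their requests to the pending actions and change no state, so the bookkeeping
survives. Only tiles of the left part are treated; `combine_comm` gives the right part. -/
theorem Evolved.combine [Fintype Γ] {A B : Supertile Γ Λ} (hd : Disjoint A.support B.support)
    {p : ℤ × ℤ} {t₀ t : Tile Γ Λ} (hp : A p = some t) (h : Evolved A p t₀ t) :
    Evolved (A.combine B) p t₀ (t.addPending (requested A B p t)) := by
  have hb : ∀ d g, _ ↔ _ := fun d g => bond_combine hd (by simp [hp]) (p := p) (d := d) (g := g)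
  have hm : ∀ {a}, Fired A p t₀ a → Fired (A.combine B) p t₀ a :=
    fun hf => hf.mono fun d g hh => (hb d g).2 (.inl hh)
  refine ⟨h.trans_eq, fun d g => ?_, fun x => ?_, fun a ha => ?_, fun a ha => ?_⟩
  · exact (h.glue_eq d g).imp_right fun ⟨h1, h2, h3⟩ => ⟨h1, h2, hm h3⟩
  · exact (h.label_eq x).imp_right fun ⟨h1, h2, h3⟩ => ⟨h1, h2, hm h3⟩
  · rcases Multiset.mem_add.1 ha with ha | ha
    · exact hm (h.fired_of_pending a ha)
    · obtain ⟨d, g, h1, h2⟩ := mem_requested.1 ha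
      exact ⟨d, g, (hb d g).2 (.inr h1), h.trans_eq ▸ h2⟩
  · obtain ⟨d, g, h1, h2⟩ := ha
    rcases (hb d g).1 h1 with h1 | h1
    · rcases h.pending_or_done a ⟨d, g, h1, h2⟩ with h3 | h3
      · exact .inl (Multiset.mem_add.2 (.inl h3))
      · right
        cases a <;> exact h3
    · exact .inl (Multiset.mem_add.2 (.inr (mem_requested.2 ⟨d, g, h1, h.trans_eq ▸ h2⟩)))

theorem addPendingAt_apply (A : Supertile Γ Λ) (p q : ℤ × ℤ) (M : Multiset (Action Γ Λ)) :
    A.addPendingAt p M q = (A q).map fun t => if q = p then t.addPending M else t := by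
  by_cases h : q = p
  · subst h; simp [addPendingAt]
  · simp [addPendingAt, h]

theorem fireBond_of_not [DecidableEq Γ] {A : Supertile Γ Λ} {p : ℤ × ℤ} {d : Dir} {g : Γ}
    (h : ¬ Bond A A p d g) : A.fireBond p d g = A := if_neg h

theorem fireBond_of_bond [DecidableEq Γ] {A : Supertile Γ Λ} {p : ℤ × ℤ} {d : Dir} {g : Γ}
    (h : Bond A A p d g) : A.fireBond p d g =
      (A.addPendingAt p (A.transAt p d g)).addPendingAt (p + d.vec)
        (A.transAt (p + d.vec) d.opp g) := if_pos h

theorem exists_fireBond_eq [DecidableEq Γ] {A : Supertile Γ Λ} {p : ℤ × ℤ} {d : Dir} {g : Γ}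
    {q : ℤ × ℤ} {t : Tile Γ Λ} (hq : A q = some t) :
    ∃ M, A.fireBond p d g q = some (t.addPending M) ∧
      ∀ a, a ∈ M ↔ Bond A A p d g ∧
        (q = p ∧ a ∈ t.trans d g ∨ q = p + d.vec ∧ a ∈ t.trans d.opp g) := by
  by_cases h : Bond A A p d g
  · have hpd : p ≠ p + d.vec := by simpa using d.vec_ne_zero
    simp only [fireBond_of_bond h, addPendingAt_apply, hq, Option.map_some]
    by_cases h1 : q = p
    · subst h1
      refine ⟨(t.trans d g).val, by simp [hpd, transAt, hq], fun a => ?_⟩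
      simp only [hpd, true_and, false_and, or_false, Finset.mem_val]
      exact (and_iff_right h).symm
    · by_cases h2 : q = p + d.vec
      · subst h2
        refine ⟨(t.trans d.opp g).val, by simp [transAt, hq, d.vec_ne_zero], fun a => ?_⟩
        simp only [h1, true_and, false_and, false_or, Finset.mem_val]
        exact (and_iff_right h).symm
      · exact ⟨0, by simp [h1, h2, Tile.addPending], by simp [h1, h2]⟩
  · exact ⟨0, by simp [fireBond_of_not h, hq, Tile.addPending],
      fun a => by simp only [h, false_and, Multiset.notMem_zero]⟩

theorem glueAt_fireBond [DecidableEq Γ] (A : Supertile Γ Λ) (p : ℤ × ℤ) (d : Dir) (g : Γ)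
    (q : ℤ × ℤ) (e : Dir) (k : Γ) : (A.fireBond p d g).glueAt q e k = A.glueAt q e k := by
  cases hq : A q with
  | none =>
    have : A.fireBond p d g q = none := by
      unfold fireBond
      split_ifs <;> simp [addPendingAt_apply, hq]
    simp [glueAt, hq, this]
  | some t =>
    obtain ⟨M, hM, -⟩ := exists_fireBond_eq (p := p) (d := d) (g := g) hq
    simp [glueAt, hq, hM, Tile.addPending]

/-- A local step of a stable supertile in which only on requests are pending preserves the tiles
with their histories, and it preserves all glues that are on. -/
theorem Evolved.localStep [DecidableEq Γ] [DecidableEq Λ] {strength : Γ → ℕ} {τ : ℕ}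
    {A A' : Supertile Γ Λ} (hA : Stable strength τ A)
    (hon : ∀ q t, A q = some t → ∀ a ∈ t.pending, a.IsOn) (h : LocalStep strength τ A A') :
    (∀ q d g, A.glueAt q d g = some .on → A'.glueAt q d g = some .on) ∧
    (∀ q, A q = none → A' q = none) ∧
    ∀ q t t₀, A q = some t → Evolved A q t₀ t → ∃ t', A' q = some t' ∧ Evolved A' q t₀ t' := by
  cases h with
  | break_apart X hX => exact absurd hX (hA X)
  | glue_activate p t d g rest ht hp hs =>
    set A₁ : Supertile Γ Λ := Function.update A p
      (some { t.setGlue d g State.on with pending := rest }) with hA₁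
    have hpd : p ≠ p + d.vec := by simpa using d.vec_ne_zero
    have h1 : ∀ q e k, A₁.glueAt q e k =
        if q = p ∧ e = d ∧ k = g then some .on else A.glueAt q e k := by
      intro q e k
      by_cases hq : q = p
      · subst hq
        by_cases he : e = d
        · subst he
          by_cases hk : k = g
          · subst hk
            simp [glueAt, A₁, Tile.setGlue]
          · simp [glueAt, A₁, Tile.setGlue, hk, ht]
        · simp [glueAt, A₁, Tile.setGlue, he, ht]
      · simp [glueAt, A₁, hq]
    have hmono : ∀ q e k, A.glueAt q e k = some .on → A₁.glueAt q e k = some .on := by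
      intro q e k hh
      rw [h1]
      split_ifs <;> simp [hh]
    have hfb : ∀ q e k, Bond (A₁.fireBond p d g) (A₁.fireBond p d g) q e k ↔ Bond A₁ A₁ q e k := by
      intro q e k
      simp only [Bond, glueAt_fireBond]
    have hbm : ∀ q e k, Bond A A q e k → Bond A₁ A₁ q e k :=
      fun q e k hh => ⟨hmono _ _ _ hh.1, hmono _ _ _ hh.2⟩
    -- A bond that is new in `A₁` must use the activated glue, at its own end or at the opposite
    -- end. These are the two tiles to which `fireBond` adds requests.
    have hnew : ∀ q e k, Bond A₁ A₁ q e k → Bond A A q e k ∨ Bond A₁ A₁ p d g ∧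
        (q = p ∧ e = d ∧ k = g ∨ q = p + d.vec ∧ e = d.opp ∧ k = g) := by
      intro q e k hh
      by_cases hc : q = p ∧ e = d ∧ k = g
      · obtain ⟨rfl, rfl, rfl⟩ := hc
        exact .inr ⟨hh, .inl ⟨rfl, rfl, rfl⟩⟩
      · by_cases hc' : q + e.vec = p ∧ e.opp = d ∧ k = g
        · obtain ⟨hq, rfl, rfl⟩ := hc'
          subst hq
          refine .inr ⟨bond_symm hh, .inr ⟨?_, (Dir.opp_opp e).symm, rfl⟩⟩
          rw [Dir.vec_opp, add_neg_cancel_right]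
        · refine .inl ⟨?_, ?_⟩
          · have := hh.1
            rwa [h1, if_neg hc] at this
          · have := hh.2
            rwa [h1, if_neg hc'] at this
    refine ⟨fun q e k hh => by rw [glueAt_fireBond]; exact hmono q e k hh, fun q hq => ?_,
      fun q u t₀ hu hev => ?_⟩
    · have hqp : q ≠ p := by rintro rfl; simp [ht] at hq
      have : A₁ q = none := by simp [A₁, hqp, hq]
      unfold fireBond
      split_ifs <;> simp [addPendingAt_apply, this]
    · have hF : ∀ {a}, Fired A q t₀ a → Fired (A₁.fireBond p d g) q t₀ a :=
        fun hf => hf.mono fun e k hh => (hfb q e k).2 (hbm q e k hh)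
      by_cases hqp : q = p
      · subst hqp
        obtain rfl : t = u := by simpa [ht] using hu
        obtain ⟨M, hM, hMa⟩ := exists_fireBond_eq (p := q) (d := d) (g := g)
          (show A₁ q = some _ from by rw [hA₁, Function.update_self])
        have hfired : Fired A q t₀ (.glue d g .on) := hev.fired_of_pending _ (by simp [hp])
        refine ⟨_, hM, hev.trans_eq, fun e k => ?_, fun x => ?_, fun a ha => ?_, fun a ha => ?_⟩
        · by_cases hek : e = d ∧ k = g
          · obtain ⟨rfl, rfl⟩ := hek
            right
            refine ⟨?_, by simp [Tile.addPending, Tile.setGlue], hF hfired⟩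
            rcases hev.glue_eq e k with h2 | ⟨h2, -⟩
            · rw [← h2, hs]
            · exact h2
          · have : (t.setGlue d g .on).glue e k = t.glue e k := by
              by_cases he : e = d
              · subst he
                have hk : k ≠ g := fun hk => hek ⟨rfl, hk⟩
                simp [Tile.setGlue, hk]
              · simp [Tile.setGlue, he]
            simp only [Tile.addPending, this]
            exact (hev.glue_eq e k).imp_right fun ⟨h1, h2, h3⟩ => ⟨h1, h2, hF h3⟩
        · exact (hev.label_eq x).imp_right fun ⟨h1, h2, h3⟩ => ⟨h1, h2, hF h3⟩
        · rcases Multiset.mem_add.1 ha with ha | ha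
          · exact hF (hev.fired_of_pending a (by rw [hp]; exact Multiset.mem_cons_of_mem ha))
          · obtain ⟨hb, hh | hh⟩ := (hMa a).1 ha
            · exact ⟨d, g, (hfb _ _ _).2 hb, hev.trans_eq ▸ hh.2⟩
            · exact absurd hh.1 hpd
        · have hdone : ∀ b, t.Done b ∨ b = .glue d g .on →
              (Tile.addPending { t.setGlue d g .on with pending := rest } M).Done b := by
            rintro b (hb | rfl)
            · cases b with
              | label x q => exact hb
              | glue e k q =>
                by_cases he : e = d
                · subst he
                  by_cases hk : k = g
                  · simp [Tile.Done, Tile.addPending, Tile.setGlue, hk]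
                  · simpa [Tile.Done, Tile.addPending, Tile.setGlue, hk] using hb
                · simpa [Tile.Done, Tile.addPending, Tile.setGlue, he] using hb
            · simp [Tile.Done, Tile.addPending, Tile.setGlue]
          obtain ⟨e, k, hb, hae⟩ := ha
          rcases hnew q e k ((hfb _ _ _).1 hb) with hb | ⟨hb, ⟨-, rfl, rfl⟩ | ⟨hc, -⟩⟩
          · rcases hev.pending_or_done a ⟨e, k, hb, hae⟩ with h3 | h3
            · rw [hp, Multiset.mem_cons] at h3
              rcases h3 with h3 | h3
              · exact .inr (hdone a (.inr h3))
              · exact .inl (Multiset.mem_add.2 (.inl h3))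
            · exact .inr (hdone a (.inl h3))
          · refine .inl (Multiset.mem_add.2 (.inr ((hMa a).2 ⟨hb, .inl ⟨rfl, ?_⟩⟩)))
            rw [← hev.trans_eq] at hae
            exact hae
          · exact absurd hc hpd
      · have hu' : A₁ q = some u := by simp [A₁, hqp, hu]
        obtain ⟨M, hM, hMa⟩ := exists_fireBond_eq (p := p) (d := d) (g := g) hu'
        refine ⟨_, hM, hev.trans_eq, fun e k => ?_, fun x => ?_, fun a ha => ?_, fun a ha => ?_⟩
        · exact (hev.glue_eq e k).imp_right fun ⟨h1, h2, h3⟩ => ⟨h1, h2, hF h3⟩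
        · exact (hev.label_eq x).imp_right fun ⟨h1, h2, h3⟩ => ⟨h1, h2, hF h3⟩
        · rcases Multiset.mem_add.1 ha with ha | ha
          · exact hF (hev.fired_of_pending a ha)
          · obtain ⟨hb, hh | hh⟩ := (hMa a).1 ha
            · exact absurd hh.1 hqp
            · obtain ⟨rfl, hh⟩ := hh
              exact ⟨d.opp, g, (hfb _ _ _).2 (bond_symm hb), hev.trans_eq ▸ hh⟩
        · obtain ⟨e, k, hb, hae⟩ := ha
          rcases hnew q e k ((hfb _ _ _).1 hb) with hb | ⟨hpg, ⟨hc, -⟩ | ⟨rfl, rfl, rfl⟩⟩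
          · rcases hev.pending_or_done a ⟨e, k, hb, hae⟩ with h3 | h3
            · exact .inl (Multiset.mem_add.2 (.inl h3))
            · right
              cases a <;> exact h3
          · exact absurd hc hqp
          · exact .inl (Multiset.mem_add.2 (.inr ((hMa a).2
              ⟨hpg, .inr ⟨rfl, hev.trans_eq ▸ hae⟩⟩)))
  | glue_other p t d g q s rest ht hp hs hne =>
    have hq : q = .on := hon p t ht (.glue d g q) (by simp [hp])
    subst hq
    -- As only on requests occur, the glue is not latent, so the execution merely removes the action
    -- from the pending ones.
    have hsl : s ≠ .latent := fun h => hne ⟨h, rfl⟩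
    have hact : s.act .on = s := by cases s <;> first | rfl | exact absurd rfl hsl
    have hset : t.setGlue d g s = t := by
      have : Function.update t.glue d (Function.update (t.glue d) g (some s)) = t.glue := by
        rw [← hs, Function.update_eq_self, Function.update_eq_self]
      simp [Tile.setGlue, this]
    rw [hact, hset]
    set A₁ : Supertile Γ Λ := Function.update A p (some { t with pending := rest }) with hA₁
    have h1 : ∀ q e k, A₁.glueAt q e k = A.glueAt q e k := by
      intro q e k
      by_cases hq : q = p
      · subst hq; simp [glueAt, A₁, ht]
      · simp [glueAt, A₁, hq]
    have hb : ∀ q e k, Bond A A q e k ↔ Bond A₁ A₁ q e k := by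
      intro q e k; simp only [Bond, h1]
    refine ⟨fun q e k hh => by rw [h1]; exact hh, fun q hq => ?_, fun q u t₀ hu hev => ?_⟩
    · have hqp : q ≠ p := by rintro rfl; simp [ht] at hq
      simp [A₁, hqp, hq]
    · by_cases hqp : q = p
      · subst hqp
        obtain rfl : t = u := by simpa [ht] using hu
        have hev' := hev.congr (hb q)
        refine ⟨_, Function.update_self .., hev'.trans_eq, hev'.glue_eq, hev'.label_eq,
          fun a ha => hev'.fired_of_pending a (by rw [hp]; exact Multiset.mem_cons_of_mem ha),
          fun a ha => ?_⟩
        rcases hev'.pending_or_done a ha with h3 | h3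
        · rw [hp, Multiset.mem_cons] at h3
          rcases h3 with rfl | h3
          · right; simp [Tile.Done, hs, hsl]
          · exact .inl h3
        · right; cases a <;> exact h3
      · exact ⟨u, by simp [A₁, hqp, hu], hev.congr (hb q)⟩
  | label p t x q s rest ht hp hs =>
    have hq : q = .on := hon p t ht (.label x q) (by simp [hp])
    subst hq
    set A₁ : Supertile Γ Λ :=
      Function.update A p (some { t.setLabel x (s.act .on) with pending := rest }) with hA₁
    have h1 : ∀ q e k, A₁.glueAt q e k = A.glueAt q e k := by
      intro q e k
      by_cases hq : q = p
      · subst hq; simp [glueAt, A₁, ht, Tile.setLabel]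
      · simp [glueAt, A₁, hq]
    have hb : ∀ q e k, Bond A A q e k ↔ Bond A₁ A₁ q e k := by
      intro q e k; simp only [Bond, h1]
    refine ⟨fun q e k hh => by rw [h1]; exact hh, fun q hq => ?_, fun q u t₀ hu hev => ?_⟩
    · have hqp : q ≠ p := by rintro rfl; simp [ht] at hq
      simp [A₁, hqp, hq]
    · by_cases hqp : q = p
      · subst hqp
        obtain rfl : t = u := by simpa [ht] using hu
        have hev' := hev.congr (hb q)
        have hfired := hev'.fired_of_pending (.label x .on) (by simp [hp])
        have hxs : s.act .on ≠ .latent := by cases s <;> simp [State.act]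
        refine ⟨_, Function.update_self .., hev'.trans_eq, hev'.glue_eq, fun z => ?_,
          fun a ha => hev'.fired_of_pending a (by rw [hp]; exact Multiset.mem_cons_of_mem ha),
          fun a ha => ?_⟩
        · by_cases hz : z = x
          · subst hz
            rcases hev'.label_eq z with h2 | ⟨h2, h3, h4⟩
            · by_cases hl : s = .latent
              · subst hl
                exact .inr ⟨by rw [← h2, hs], by simp [Tile.setLabel, State.act], hfired⟩
              · left
                have : s.act .on = s := by cases s <;> first | rfl | exact absurd rfl hl
                simp [Tile.setLabel, this, ← h2, hs]
            · right
              obtain rfl : s = .on := by simpa [hs] using h3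
              exact ⟨h2, by simp [Tile.setLabel, State.act], h4⟩
          · simpa [Tile.setLabel, hz] using hev'.label_eq z
        · rcases hev'.pending_or_done a ha with h3 | h3
          · rw [hp, Multiset.mem_cons] at h3
            rcases h3 with rfl | h3
            · right; simp [Tile.Done, Tile.setLabel, hxs]
            · exact .inl h3
          · right
            cases a with
            | glue e k q => exact h3
            | label z q =>
              by_cases hz : z = x
              · subst hz
                simp [Tile.Done, Tile.setLabel, hxs]
              · simpa [Tile.Done, Tile.setLabel, hz] using h3
      · exact ⟨u, by simp [A₁, hqp, hu], hev.congr (hb q)⟩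

end Supertile

open Supertile

namespace Sierpinski

/-! ### The five tiles and their signals. -/

/-- Glues `x` and `y` build the two axes, `w b` passes the value `b` to the east, and `v a b` passes
the value `a` to the north, to a tile whose western neighbour has the value `b`. -/
inductive Glue where
  | x
  | y
  | w (b : Bool)
  | v (a b : Bool)
  deriving DecidableEq, Fintype

/-- The tiles: the seed, the tiles of the two axes, and the tiles that have a western neighbour with
value `b`. -/
inductive Kind where
  | seed
  | xAxis
  | yAxis
  | inner (b : Bool)
  deriving DecidableEq, Fintype

/-- The initial states of the glues. -/
def Kind.glue : Kind → Dir → Glue → Option State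
  | .seed, .north, .y => some .on
  | .seed, .east, .x => some .on
  | .xAxis, .west, .x => some .on
  | .xAxis, .east, .x => some .latent
  | .xAxis, .north, .v true _ => some .latent
  | .yAxis, .south, .y => some .on
  | .yAxis, .north, .y => some .latent
  | .yAxis, .east, .w true => some .latent
  | .inner b, .west, .w c => if c = b then some .on else none
  | .inner b, .south, .v _ c => if c = b then some .latent else none
  | .inner _, .east, .w _ => some .latent
  | .inner _, .north, .v _ _ => some .latent
  | _, _, _ => none

/-- The initial state of the label. -/
def Kind.label : Kind → State
  | .inner _ => .latent
  | _ => .on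

/-- The actions requested by a bond. A tile with western value `b` and southern value `a` has the
value `xor a b`. -/
def Kind.requests : Kind → Dir → Glue → List (Action Glue Unit)
  | .xAxis, .west, .x =>
      [.glue .east .x .on, .glue .north (.v true false) .on, .glue .north (.v true true) .on]
  | .yAxis, .south, .y => [.glue .north .y .on, .glue .east (.w true) .on]
  | .inner b, .west, .w c =>
      if c = b then [.glue .south (.v false b) .on, .glue .south (.v true b) .on] else []
  | .inner b, .south, .v a c =>
      if c = b then
        [.glue .east (.w (xor a b)) .on, .glue .north (.v (xor a b) false) .on,
          .glue .north (.v (xor a b) true) .on] ++ if xor a b then [.label () .on] else []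
      else []
  | _, _, _ => []

theorem Kind.requests_nodup (k : Kind) (d : Dir) (g : Glue) : (k.requests d g).Nodup := by
  rcases k with _ | _ | _ | b <;> cases d <;> rcases g with _ | _ | c | ⟨a, c⟩ <;>
    simp [Kind.requests]
  · split_ifs <;> simp
  · split_ifs <;> simp

/-- The initial tile of a kind. -/
def Kind.tile (k : Kind) : Tile Glue Unit where
  glue := k.glue
  label _ := some k.label
  trans d g := ⟨k.requests d g, k.requests_nodup d g⟩
  pending := 0

/-- The side and the glue by which a tile attaches. -/
def Kind.input : Kind → Option (Dir × Glue)
  | .seed => none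
  | .xAxis => some (.west, .x)
  | .yAxis => some (.south, .y)
  | .inner b => some (.west, .w b)

theorem Kind.mem_trans {k : Kind} {d : Dir} {g : Glue} {a : Action Glue Unit} :
    a ∈ k.tile.trans d g ↔ a ∈ k.requests d g := Iff.rfl

theorem Kind.isOn_of_mem {k : Kind} {d : Dir} {g : Glue} {a : Action Glue Unit}
    (h : a ∈ k.requests d g) : a.IsOn := by
  revert h
  rcases k with _ | _ | _ | b <;> cases d <;> rcases g with _ | _ | c | ⟨e, c⟩ <;>
    simp only [Kind.requests, List.not_mem_nil, false_imp_iff]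
  · rintro h
    simp only [List.mem_cons, List.not_mem_nil, or_false] at h
    rcases h with rfl | rfl | rfl <;> rfl
  · rintro h
    simp only [List.mem_cons, List.not_mem_nil, or_false] at h
    rcases h with rfl | rfl <;> rfl
  · split_ifs
    · rintro h
      simp only [List.mem_append, List.mem_cons, List.not_mem_nil, or_false] at h
      rcases h with (rfl | rfl | rfl) | rfl <;> rfl
    · rintro h
      simp only [List.append_nil, List.mem_cons, List.not_mem_nil, or_false] at h
      rcases h with rfl | rfl | rfl <;> rfl
    · simp
  · split_ifs
    · rintro h
      simp only [List.mem_cons, List.not_mem_nil, or_false] at h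
      rcases h with rfl | rfl <;> rfl
    · simp

theorem Kind.requests_east (k : Kind) (g : Glue) : k.requests .east g = [] := by
  cases k <;> rfl

theorem Kind.requests_north (k : Kind) (g : Glue) : k.requests .north g = [] := by
  cases k <;> rfl

theorem Kind.glue_ne_off (k : Kind) (d : Dir) (g : Glue) : k.glue d g ≠ some .off := by
  revert k d g; decide

theorem Kind.input_of_west {k : Kind} {g : Glue} (h : k.glue .west g ≠ none) :
    k.input = some (.west, g) := by
  revert k g; decide

theorem Kind.input_of_south {k : Kind} {g : Glue} (h : k.glue .south g ≠ none) :
    k.input = some (.south, g) ∨ ∃ a b, k = .inner b ∧ g = .v a b := by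
  revert k g; decide

/-- Apart from the seed, each tile starts with exactly one glue on, so a fresh tile can bind in only
one way. -/
theorem Kind.input_of_on {k : Kind} (hk : k ≠ .seed) {d : Dir} {g : Glue}
    (h : k.glue d g = some .on) : k.input = some (d, g) := by
  revert k d g; decide

theorem Kind.inner_glue_ne_on (b : Bool) (g : Glue) :
    (Kind.inner b).glue .east g ≠ some .on ∧ (Kind.inner b).glue .north g ≠ some .on := by
  revert b g; decide

theorem Kind.glue_input {k : Kind} {d : Dir} {g : Glue} (h : k.input = some (d, g)) :
    k.glue d g = some .on := by
  revert k d g; decide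

theorem Kind.input_side {k : Kind} {d : Dir} {g : Glue} (h : k.input = some (d, g)) :
    d = .west ∨ d = .south := by
  revert k d g; decide

/-! ### Binomial parities and coordinates relative to the seed. -/

/-- The parity of the binomial coefficient `x + y` over `x`. -/
def val (x y : ℕ) : Bool := ((x + y).choose x).bodd

theorem val_zero_left (y : ℕ) : val 0 y = true := by simp [val]

theorem val_zero_right (x : ℕ) : val x 0 = true := by simp [val]

theorem val_succ_succ (x y : ℕ) : val (x + 1) (y + 1) = xor (val (x + 1) y) (val x (y + 1)) := by
  have : x + 1 + (y + 1) = (x + (y + 1)) + 1 := by ring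
  simp only [val]
  rw [this, Nat.choose_succ_succ, Nat.bodd_add, Bool.xor_comm, show x + (y + 1) = x + 1 + y by ring]

/-- The kind of the tile at a position relative to the seed. -/
def kind : ℕ → ℕ → Kind
  | 0, 0 => .seed
  | _ + 1, 0 => .xAxis
  | 0, _ + 1 => .yAxis
  | x + 1, y + 1 => .inner (val x (y + 1))

/-- The position `(x, y)` relative to `o`. -/
def pos (o : ℤ × ℤ) (x y : ℕ) : ℤ × ℤ := (o.1 + x, o.2 + y)

theorem pos_zero (o : ℤ × ℤ) : pos o 0 0 = o := by simp [pos]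

theorem pos_east (o : ℤ × ℤ) (x y : ℕ) : pos o x y + Dir.east.vec = pos o (x + 1) y := by
  simp [pos, Dir.vec, add_assoc]

theorem pos_north (o : ℤ × ℤ) (x y : ℕ) : pos o x y + Dir.north.vec = pos o x (y + 1) := by
  simp [pos, Dir.vec, add_assoc]

theorem pos_west (o : ℤ × ℤ) (x y : ℕ) : pos o (x + 1) y + Dir.west.vec = pos o x y := by
  simp [pos, Dir.vec, add_assoc]

theorem pos_south (o : ℤ × ℤ) (x y : ℕ) : pos o x (y + 1) + Dir.south.vec = pos o x y := by
  simp [pos, Dir.vec, add_assoc]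

theorem pos_inj {o : ℤ × ℤ} {x y x' y' : ℕ} (h : pos o x y = pos o x' y') : x = x' ∧ y = y' := by
  simpa [pos] using h

/-! ### The growth invariant and its consequences. -/

/-- A supertile grown from a seed at `o`. -/
structure Seeded (o : ℤ × ℤ) (A : Supertile Glue Unit) : Prop where
  evolved : ∀ x y t, A (pos o x y) = some t → Evolved A (pos o x y) (kind x y).tile t
  exists_pos : ∀ p, A p ≠ none → ∃ x y, p = pos o x y
  seed : A o ≠ none
  bond : ∀ x y, A (pos o x y) ≠ none → ∀ d g, (kind x y).input = some (d, g) →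
    Bond A A (pos o x y) d g

section Seeded

variable {o : ℤ × ℤ} {A : Supertile Glue Unit}

theorem Seeded.parent (h : Seeded o A) {x y : ℕ} (hp : A (pos o x y) ≠ none) {d : Dir} {g : Glue}
    (hk : (kind x y).input = some (d, g)) : A (pos o x y + d.vec) ≠ none :=
  ne_none_of_glueAt (h.bond x y hp d g hk).2

theorem Seeded.glue_ne_none (h : Seeded o A) {x y : ℕ} {d : Dir} {g : Glue} {s : State}
    (hg : A.glueAt (pos o x y) d g = some s) : (kind x y).glue d g ≠ none := by
  obtain ⟨t, ht, hs⟩ := glueAt_eq_some.1 hg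
  rcases (h.evolved x y t ht).glue_eq d g with h1 | ⟨h1, -⟩
  · intro h2
    have : t.glue d g = none := h1.trans h2
    simp [this] at hs
  · intro h2
    have : (kind x y).tile.glue d g = none := h2
    simp [this] at h1

/-- The outputs of an inner tile start latent and only southern bonds request them. An output that
is on thus certifies a bond to the tile below. -/
theorem Seeded.bond_of_on (h : Seeded o A) {x y : ℕ} {d : Dir} {g : Glue}
    (hg : A.glueAt (pos o (x + 1) (y + 1)) d g = some .on) (hd : d = .east ∨ d = .north) :
    ∃ a, Bond A A (pos o (x + 1) (y + 1)) .south (.v a (val x (y + 1))) ∧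
      .glue d g .on ∈ (Kind.inner (val x (y + 1))).requests .south (.v a (val x (y + 1))) := by
  obtain ⟨t, ht, hs⟩ := glueAt_eq_some.1 hg
  have hne := h.glue_ne_none hg
  have hev := h.evolved _ _ t ht
  rcases hev.glue_eq d g with h1 | ⟨-, -, e, k, hb, hr⟩
  · exfalso
    have : (kind (x + 1) (y + 1)).glue d g = some .on := h1.symm.trans hs
    simp only [kind] at this
    rcases hd with rfl | rfl
    · exact (Kind.inner_glue_ne_on _ _).1 this
    · exact (Kind.inner_glue_ne_on _ _).2 this
  · rw [Kind.mem_trans] at hr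
    have hk := h.glue_ne_none hb.1
    simp only [kind] at hr hk
    cases e with
    | east => simp [Kind.requests_east] at hr
    | north => simp [Kind.requests_north] at hr
    | west =>
      exfalso
      rcases k with _ | _ | c | ⟨a, c⟩ <;> simp only [Kind.requests, List.not_mem_nil] at hr
      split_ifs at hr <;> rcases hd with rfl | rfl <;> simp at hr
    | south =>
      rcases Kind.input_of_south hk with hi | ⟨a, b, hi, rfl⟩
      · simp [Kind.input] at hi
      · obtain rfl : val x (y + 1) = b := by simpa using hi
        exact ⟨a, hb, hr⟩

/-- Induction on the row. An inner output stems from a southern bond, which carries the correct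
value by the row below, and the western value is part of the kind. The axis tiles have output value
glues for `true` only. -/
theorem Seeded.val_eq (h : Seeded o A) (y : ℕ) : ∀ x c,
    (∀ e, A.glueAt (pos o x y) .north (.v c e) = some .on → c = val x y) ∧
      (A.glueAt (pos o x y) .east (.w c) = some .on → c = val x y) := by
  induction y with
  | zero =>
    rintro x c
    rw [val_zero_right]
    constructor
    · intro e hg
      have := h.glue_ne_none hg
      clear hg
      revert this
      rcases x with _ | x <;> simp only [kind] <;> revert c e <;> decide
    · intro hg
      have := h.glue_ne_none hg
      clear hg
      revert this
      rcases x with _ | x <;> simp only [kind] <;> revert c <;> decide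
  | succ y ih =>
    rintro (_ | x) c
    · rw [val_zero_left]
      constructor
      · intro e hg
        have := h.glue_ne_none hg
        clear hg
        revert this
        simp only [kind]
        revert c e
        decide
      · intro hg
        have := h.glue_ne_none hg
        clear hg
        revert this
        simp only [kind]
        revert c
        decide
    · have key : ∀ a, Bond A A (pos o (x + 1) (y + 1)) .south (.v a (val x (y + 1))) →
          a = val (x + 1) y := by
        intro a hb
        have := hb.2
        rw [pos_south] at this
        exact (ih (x + 1) a).1 _ this
      constructor
      · intro e hg
        obtain ⟨a, hb, hr⟩ := h.bond_of_on hg (.inr rfl)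
        rw [val_succ_succ, ← key a hb]
        simp only [Kind.requests, if_true] at hr
        split_ifs at hr with hab <;> simp at hr <;> tauto
      · intro hg
        obtain ⟨a, hb, hr⟩ := h.bond_of_on hg (.inl rfl)
        rw [val_succ_succ, ← key a hb]
        simp only [Kind.requests, if_true] at hr
        split_ifs at hr with hab <;> simp at hr <;> tauto

/-- The western neighbour already shows an eastern output. If it is on the y-axis, its attachment
bond goes south; if it is an inner tile, `bond_of_on` gives it a southern bond. -/
theorem Seeded.diagonal (h : Seeded o A) {x y : ℕ} (hp : A (pos o (x + 1) (y + 1)) ≠ none) :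
    A (pos o x y) ≠ none := by
  have hb := (h.bond _ _ hp .west (.w (val x (y + 1))) rfl).2
  rw [pos_west] at hb
  rcases x with _ | x
  · have := h.parent (ne_none_of_glueAt hb) (d := .south) (g := .y) rfl
    rwa [pos_south] at this
  · obtain ⟨a, hb', -⟩ := h.bond_of_on hb (.inl rfl)
    have := ne_none_of_glueAt hb'.2
    rwa [pos_south] at this

/-- A cut without bonds is a union of components of the binding graph. -/
theorem mem_iff_of_bond {X : Set (ℤ × ℤ)}
    (h : ¬ ∃ p d g, Bond (A.restrict X) (A.restrict Xᶜ) p d g) {p : ℤ × ℤ} {d : Dir} {g : Glue}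
    (hb : Bond A A p d g) : p ∈ X ↔ p + d.vec ∈ X := by
  by_contra hc
  apply h
  by_cases hp : p ∈ X
  · have hq : p + d.vec ∉ X := fun hq => hc (by simp [hp, hq])
    refine ⟨p, d, g, ?_, ?_⟩
    · rw [glueAt_congr (B := A) (by simp [restrict, hp])]; exact hb.1
    · rw [glueAt_congr (B := A) (by simp [restrict, hq])]; exact hb.2
  · have hq : p + d.vec ∈ X := by by_contra hq; exact hc (by simp [hp, hq])
    refine ⟨p + d.vec, d.opp, g, ?_, ?_⟩
    · rw [glueAt_congr (B := A) (by simp [restrict, hq])]; exact hb.2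
    · have := (bond_symm hb).2
      rw [glueAt_congr (B := A)]; exact this
      rw [Dir.vec_opp, add_neg_cancel_right]
      simp [restrict, hp]

/-- Attachment bonds lead from each tile to one with smaller `x + y`, hence eventually to the seed,
so the binding graph is connected. -/
theorem Seeded.stable (h : Seeded o A) : Stable (fun _ => 1) 1 A := by
  rintro X ⟨⟨p, hp⟩, ⟨q, hq⟩, hX⟩
  rw [bondStrengthGE_one_iff (fun _ => rfl)] at hX
  have key : ∀ n x y, x + y = n → A (pos o x y) ≠ none → (pos o x y ∈ X ↔ o ∈ X) := by
    intro n
    induction n with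
    | zero =>
      intro x y hn _
      obtain ⟨rfl, rfl⟩ : x = 0 ∧ y = 0 := by omega
      rw [pos_zero]
    | succ n ih =>
      intro x y hn hxy
      rcases x with _ | x <;> rcases y with _ | y
      · omega
      · have h1 := mem_iff_of_bond hX (h.bond _ _ hxy .south .y rfl)
        have h2 := h.parent hxy (d := .south) (g := .y) rfl
        rw [pos_south] at h1 h2
        rw [h1, ih _ _ (by omega) h2]
      · have h1 := mem_iff_of_bond hX (h.bond _ _ hxy .west .x rfl)
        have h2 := h.parent hxy (d := .west) (g := .x) rfl
        rw [pos_west] at h1 h2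
        rw [h1, ih _ _ (by omega) h2]
      · have h1 := mem_iff_of_bond hX (h.bond _ _ hxy .west (.w _) rfl)
        have h2 := h.parent hxy (d := .west) (g := .w _) rfl
        rw [pos_west] at h1 h2
        rw [h1, ih _ _ (by omega) h2]
  have key' : ∀ p, A p ≠ none → (p ∈ X ↔ o ∈ X) := by
    intro p hp
    obtain ⟨x, y, rfl⟩ := h.exists_pos p hp
    exact key _ x y rfl hp
  simp only [support, restrict, Set.mem_ofPred_eq] at hp hq
  split_ifs at hp hq with h1 h2
  · exact h2 ((key' q hq).2 ((key' p hp).1 h1))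
  · simp at hq
  all_goals simp at hp

theorem Seeded.localStep (h : Seeded o A) {A' : Supertile Glue Unit}
    (hs : LocalStep (fun _ => 1) 1 A A') : Seeded o A' := by
  have hon : ∀ q t, A q = some t → ∀ a ∈ t.pending, a.IsOn := by
    intro q t hq a ha
    obtain ⟨x, y, rfl⟩ := h.exists_pos q (by simp [hq])
    obtain ⟨d, g, -, hr⟩ := (h.evolved x y t hq).fired_of_pending a ha
    exact Kind.isOn_of_mem hr
  obtain ⟨h1, h2, h3⟩ := Evolved.localStep h.stable hon hs
  have hb : ∀ p d g, Bond A A p d g → Bond A' A' p d g :=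
    fun p d g hh => ⟨h1 _ _ _ hh.1, h1 _ _ _ hh.2⟩
  have hsupp : ∀ p, A' p ≠ none → A p ≠ none := fun p hp hA => hp (h2 p hA)
  refine ⟨fun x y t ht => ?_, fun p hp => h.exists_pos p (hsupp p hp), ?_,
    fun x y hp d g hk => hb _ _ _ (h.bond x y (hsupp _ hp) d g hk)⟩
  · obtain ⟨u, hu⟩ := Option.ne_none_iff_exists'.1 (hsupp (pos o x y) (by simp [ht]))
    obtain ⟨t', ht', hev⟩ := h3 _ u _ hu (h.evolved x y u hu)
    obtain rfl : t' = t := by simpa [ht] using ht'.symm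
    exact hev
  · obtain ⟨u, hu⟩ := Option.ne_none_iff_exists'.1 h.seed
    have hev := h.evolved 0 0 u (by rw [pos_zero, hu])
    rw [pos_zero] at hev
    obtain ⟨t', ht', -⟩ := h3 _ u _ hu hev
    simp [ht']

/-- If the glue of `B` is the one by which its tile attached, then the parent of that tile in `B`
occupies `p`, against disjointness. Otherwise it is a southern value glue of an inner tile. Then `B`
has a tile west of `p` by `diagonal`; but so does `A`, since a tile with value glues on its northern
side attached from the west. -/
theorem Seeded.false_of_bond {o' : ℤ × ℤ} {B : Supertile Glue Unit} (hA : Seeded o A)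
    (hB : Seeded o' B) (hd : Disjoint A.support B.support) {p : ℤ × ℤ} {d : Dir} {g : Glue}
    (hb : Bond A B p d g) (hdir : d = .east ∨ d = .north) : False := by
  have hAp := ne_none_of_glueAt hb.1
  have hBp := eq_none_of_disjoint hd hAp
  have hBq := ne_none_of_glueAt hb.2
  obtain ⟨x, y, hq⟩ := hB.exists_pos _ hBq
  have h2 := hb.2
  rw [hq] at h2 hBq
  have hne := hB.glue_ne_none h2
  have hpar : (kind x y).input ≠ some (d.opp, g) := by
    intro hi
    have := hB.parent hBq hi
    rw [← hq, Dir.vec_opp, add_neg_cancel_right] at this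
    exact this hBp
  rcases hdir with rfl | rfl
  · exact hpar (Kind.input_of_west hne)
  · rcases Kind.input_of_south hne with hi | ⟨a, b, hi, rfl⟩
    · exact hpar hi
    · rcases x with _ | x <;> rcases y with _ | y <;> simp only [kind, reduceCtorEq] at hi
      have hdiag := hB.diagonal hBq
      have hp : p = pos o' (x + 1) y := by
        rw [← pos_south, ← hq]
        simp [Dir.vec, add_assoc]
      have hpw : pos o' x y = p + Dir.west.vec := by rw [hp, pos_west]
      rw [hpw] at hdiag
      obtain ⟨x', y', rfl⟩ := hA.exists_pos p hAp
      have hne' := hA.glue_ne_none hb.1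
      have : A (pos o x' y' + Dir.west.vec) ≠ none := by
        rcases x' with _ | x' <;> rcases y' with _ | y'
        · simp [kind, Kind.glue] at hne'
        · simp [kind, Kind.glue] at hne'
        · exact hA.parent hAp (g := .x) rfl
        · exact hA.parent hAp (g := .w _) rfl
      exact hdiag (eq_none_of_disjoint hd this)

theorem Seeded.not_combinable {o' : ℤ × ℤ} {B : Supertile Glue Unit} (hA : Seeded o A)
    (hB : Seeded o' B) : ¬ Combinable (fun _ => 1) 1 A B := by
  rintro ⟨-, -, hd, hb⟩
  obtain ⟨p, d, g, hb⟩ := (bondStrengthGE_one_iff fun _ => rfl).1 hb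
  cases d with
  | east => exact hA.false_of_bond hB hd hb (.inl rfl)
  | north => exact hA.false_of_bond hB hd hb (.inr rfl)
  | west => exact hB.false_of_bond hA hd.symm (bond_symm hb) (.inl rfl)
  | south => exact hB.false_of_bond hA hd.symm (bond_symm hb) (.inr rfl)

theorem Seeded.translate (h : Seeded o A) (v : ℤ × ℤ) : Seeded (o + v) (A.translate v) := by
  have hpos : ∀ x y, pos (o + v) x y - v = pos o x y := by
    intro x y
    ext <;> simp [pos] <;> ring
  have hg : ∀ p d g, (A.translate v).glueAt p d g = A.glueAt (p - v) d g := fun _ _ _ => rfl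
  have hb : ∀ p d g, Bond (A.translate v) (A.translate v) p d g ↔ Bond A A (p - v) d g := by
    intro p d g
    simp only [Bond, hg, add_sub_right_comm]
  refine ⟨fun x y t ht => ?_, fun p hp => ?_, ?_, fun x y hp d g hk => ?_⟩
  · have ht' : A (pos o x y) = some t := by rw [← hpos]; exact ht
    have hev := h.evolved x y t ht'
    have hF : ∀ a, Fired (A.translate v) (pos (o + v) x y) (kind x y).tile a ↔
        Fired A (pos o x y) (kind x y).tile a := by
      intro a
      simp only [Fired, hb, hpos]
    exact ⟨hev.trans_eq, by simpa only [hF] using hev.glue_eq,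
      by simpa only [hF] using hev.label_eq, by simpa only [hF] using hev.fired_of_pending,
      by simpa only [hF] using hev.pending_or_done⟩
  · obtain ⟨x, y, hxy⟩ := h.exists_pos (p - v) hp
    exact ⟨x, y, by rw [← sub_left_inj (a := v), hpos, hxy]⟩
  · simpa [Supertile.translate] using h.seed
  · rw [hb, hpos]
    refine h.bond x y ?_ d g hk
    rw [← hpos]
    exact hp

end Seeded

/-! ### Attachment of single tiles. -/

/-- The supertile that consists of the initial tile of kind `k`, at position `q`. -/
def singleAt (q : ℤ × ℤ) (k : Kind) : Supertile Glue Unit := (single k.tile).translate q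

theorem singleAt_apply (q : ℤ × ℤ) (k : Kind) (p : ℤ × ℤ) :
    singleAt q k p = if p = q then some k.tile else none := by
  simp [singleAt, Supertile.translate, single, sub_eq_zero]

theorem singleAt_ne_none {q p : ℤ × ℤ} {k : Kind} : singleAt q k p ≠ none ↔ p = q := by
  simp [singleAt_apply]

theorem singleAt_stable (q : ℤ × ℤ) (k : Kind) : Stable (fun _ => 1) 1 (singleAt q k) := by
  rintro X ⟨⟨p, hp⟩, ⟨r, hr⟩, -⟩
  simp only [support, restrict, Set.mem_ofPred_eq] at hp hr
  split_ifs at hp hr with h1 h2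
  · rw [singleAt_ne_none] at hp hr
    subst hp hr
    exact h2 h1
  · simp at hr
  all_goals simp at hp

theorem glueAt_singleAt {q p : ℤ × ℤ} {k : Kind} {d : Dir} {g : Glue} {s : State} :
    (singleAt q k).glueAt p d g = some s ↔ p = q ∧ k.glue d g = some s := by
  rw [glueAt_eq_some]
  simp [singleAt_apply, Kind.tile]

theorem not_bond_singleAt (q : ℤ × ℤ) (k : Kind) (p : ℤ × ℤ) (d : Dir) (g : Glue) :
    ¬ Bond (singleAt q k) (singleAt q k) p d g := by
  rintro ⟨h1, h2⟩
  rw [glueAt_singleAt] at h1 h2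
  obtain ⟨rfl, -⟩ := h1
  exact d.vec_ne_zero (by simpa using h2.1)

theorem evolved_singleAt (q : ℤ × ℤ) (k : Kind) : Evolved (singleAt q k) q k.tile k.tile := by
  refine ⟨rfl, fun _ _ => .inl rfl, fun _ => .inl rfl, fun a ha => ?_, fun a ha => ?_⟩
  · simp [Kind.tile] at ha
  · obtain ⟨d, g, hb, -⟩ := ha
    exact (not_bond_singleAt _ _ _ _ _ hb).elim

theorem seeded_singleAt (q : ℤ × ℤ) : Seeded q (singleAt q .seed) := by
  have hpos : ∀ x y, singleAt q .seed (pos q x y) ≠ none → x = 0 ∧ y = 0 := by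
    intro x y h
    rw [singleAt_ne_none] at h
    exact pos_inj (o := q) (by rw [h, pos_zero])
  refine ⟨fun x y t ht => ?_, fun p hp => ?_, by simp [singleAt_apply], fun x y hp d g hk => ?_⟩
  · obtain ⟨rfl, rfl⟩ := hpos x y (by simp [ht])
    rw [pos_zero] at ht ⊢
    obtain rfl : Kind.seed.tile = t := by simpa [singleAt_apply] using ht
    exact evolved_singleAt q .seed
  · rw [singleAt_ne_none] at hp
    exact ⟨0, 0, by rw [pos_zero, hp]⟩
  · obtain ⟨rfl, rfl⟩ := hpos x y hp
    simp [kind, Kind.input] at hk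

/-- The only glue of the lone tile that is on faces west or south, so the tile lands east or north
of a tile of `A`. The glue type forces the kind, and for an inner tile the value carried is correct
by `val_eq`. -/
theorem Seeded.exists_pos_of_bond {o : ℤ × ℤ} {A : Supertile Glue Unit} (h : Seeded o A)
    {q : ℤ × ℤ} {k : Kind} (hk : k ≠ .seed) {p : ℤ × ℤ} {d : Dir} {g : Glue}
    (hb : Bond A (singleAt q k) p d g) :
    (d = .east ∨ d = .north) ∧ k.input = some (d.opp, g) ∧ q = p + d.vec ∧
      ∃ x y, q = pos o x y ∧ kind x y = k := by
  obtain ⟨h1, h2⟩ := hb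
  rw [glueAt_singleAt] at h2
  obtain ⟨rfl, h2⟩ := h2
  have hi := Kind.input_of_on hk h2
  have hd : d = .east ∨ d = .north := by
    rcases Kind.input_side hi with hd | hd <;> cases d <;> simp [Dir.opp] at hd ⊢
  refine ⟨hd, hi, rfl, ?_⟩
  obtain ⟨x, y, rfl⟩ := h.exists_pos p (ne_none_of_glueAt h1)
  have hne := h.glue_ne_none h1
  rcases hd with rfl | rfl
  · refine ⟨x + 1, y, pos_east .., ?_⟩
    rcases k with _ | _ | _ | b <;> simp [Kind.input, Dir.opp] at hi
    · subst hi
      rcases y with _ | y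
      · rfl
      · rcases x with _ | x <;> simp [kind, Kind.glue] at hne
    · subst hi
      rcases y with _ | y
      · rcases x with _ | x <;> simp [kind, Kind.glue] at hne
      · simp only [kind, Kind.inner.injEq]
        exact ((h.val_eq _ _ _).2 h1).symm
  · refine ⟨x, y + 1, pos_north .., ?_⟩
    rcases k with _ | _ | _ | b <;> simp [Kind.input, Dir.opp] at hi
    subst hi
    rcases x with _ | x
    · rfl
    · rcases y with _ | y <;> simp [kind, Kind.glue] at hne

theorem Seeded.combine {o : ℤ × ℤ} {A : Supertile Glue Unit} (h : Seeded o A)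
    {q : ℤ × ℤ} {k : Kind} (hk : k ≠ .seed)
    (hc : Combinable (fun _ => 1) 1 A (singleAt q k)) : Seeded o (A.combine (singleAt q k)) := by
  obtain ⟨-, -, hd, hb⟩ := hc
  obtain ⟨p, d, g, hb⟩ := (bondStrengthGE_one_iff fun _ => rfl).1 hb
  obtain ⟨hdir, hi, hqp, x₀, y₀, hq, hkind⟩ := h.exists_pos_of_bond hk hb
  have hmono : ∀ r e l, Bond A A r e l → Bond (A.combine (singleAt q k)) (A.combine (singleAt q k))
      r e l := fun r e l hh => (bond_combine hd (ne_none_of_glueAt hh.1)).2 (.inl hh)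
  have hne : ∀ r, A.combine (singleAt q k) r ≠ none → A r ≠ none ∨ r = q := by
    intro r hr
    by_contra hcon
    rw [not_or, not_not] at hcon
    exact hr (combine_eq_none.2 ⟨hcon.1, by simp [singleAt_apply, hcon.2]⟩)
  refine ⟨fun x y t ht => ?_, fun r hr => ?_, fun hn => h.seed (combine_eq_none.1 hn).1,
    fun x y hp e l hl => ?_⟩
  · cases hA : A (pos o x y) with
    | some u =>
      obtain rfl : _ = t := by simpa [combine_of_left hA] using ht
      exact (h.evolved x y u hA).combine hd hA
    | none =>
      obtain hr | hr := hne (pos o x y) (by simp [ht])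
      · exact absurd hA hr
      · obtain ⟨rfl, rfl⟩ := pos_inj (hr.trans hq)
        have hs : singleAt q k (pos o x y) = some k.tile := by simp [singleAt_apply, hr]
        rw [combine_comm hd] at ht ⊢
        obtain rfl : _ = t := by simpa [combine_of_left hs] using ht
        rw [hkind]
        refine Evolved.combine hd.symm hs ?_
        rw [hr]
        exact evolved_singleAt q k
  · rcases hne r hr with hr | rfl
    · exact h.exists_pos r hr
    · exact ⟨x₀, y₀, hq⟩
  · rcases hne _ hp with hr | hr
    · exact hmono _ _ _ (h.bond x y hr e l hl)
    · obtain ⟨rfl, rfl⟩ := pos_inj (hr.trans hq)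
      rw [hkind, hi] at hl
      obtain ⟨rfl, rfl⟩ : d.opp = e ∧ g = l := by simpa using hl
      have hC : Bond (A.combine (singleAt q k)) (A.combine (singleAt q k)) p d g :=
        (bond_combine hd (ne_none_of_glueAt hb.1)).2 (.inr hb)
      have hC' := bond_symm hC
      rw [← hqp, ← hr] at hC'
      rw [← hr]
      exact hC'

/-! ### Classification of the producible supertiles. -/

/-- A supertile that is either a single tile other than the seed or grown from a seed. -/
def Regular (A : Supertile Glue Unit) : Prop :=
  (∃ q k, k ≠ .seed ∧ A = singleAt q k) ∨ ∃ o, Seeded o A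

theorem Regular.stable {A : Supertile Glue Unit} (h : Regular A) : Stable (fun _ => 1) 1 A := by
  rcases h with ⟨q, k, -, rfl⟩ | ⟨o, h⟩
  · exact singleAt_stable q k
  · exact h.stable

theorem Regular.translate {A : Supertile Glue Unit} (h : Regular A) (v : ℤ × ℤ) :
    Regular (A.translate v) := by
  rcases h with ⟨q, k, hk, rfl⟩ | ⟨o, h⟩
  · refine .inl ⟨q + v, k, hk, ?_⟩
    funext p
    change singleAt q k (p - v) = _
    simp [singleAt_apply, sub_eq_iff_eq_add]
  · exact .inr ⟨_, h.translate v⟩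

theorem not_localStep_singleAt {q : ℤ × ℤ} {k : Kind} {A : Supertile Glue Unit} :
    ¬ LocalStep (fun _ => 1) 1 (singleAt q k) A := by
  have hpend : ∀ p t, singleAt q k p = some t → t.pending = 0 := by
    intro p t ht
    rw [singleAt_apply] at ht
    split_ifs at ht
    obtain rfl : k.tile = t := by simpa using ht
    rfl
  intro h
  cases h with
  | break_apart X hX => exact singleAt_stable q k X hX
  | glue_activate p t d g rest ht hp hs => simp [hpend p t ht] at hp
  | glue_other p t d g q s rest ht hp hs hne => simp [hpend p t ht] at hp
  | label p t x q s rest ht hp hs => simp [hpend p t ht] at hp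

/-- Both tiles have glues on only to the west or south, and two abutting sides cannot both face
these directions. -/
theorem not_combinable_singleAt {q q' : ℤ × ℤ} {k k' : Kind} (hk : k ≠ .seed) (hk' : k' ≠ .seed) :
    ¬ Combinable (fun _ => 1) 1 (singleAt q k) (singleAt q' k') := by
  rintro ⟨-, -, -, hb⟩
  obtain ⟨p, d, g, h1, h2⟩ := (bondStrengthGE_one_iff fun _ => rfl).1 hb
  rw [glueAt_singleAt] at h1 h2
  have h1 := Kind.input_side (Kind.input_of_on hk h1.2)
  have h2 := Kind.input_side (Kind.input_of_on hk' h2.2)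
  rcases h1 with rfl | rfl <;> simp [Dir.opp] at h2

theorem Regular.combine {A B : Supertile Glue Unit} (hA : Regular A) (hB : Regular B)
    (hc : Combinable (fun _ => 1) 1 A B) : ∃ o, Seeded o (A.combine B) := by
  rcases hA with ⟨q, k, hk, rfl⟩ | ⟨o, hA⟩ <;> rcases hB with ⟨q', k', hk', rfl⟩ | ⟨o', hB⟩
  · exact absurd hc (not_combinable_singleAt hk hk')
  · refine ⟨o', ?_⟩
    rw [combine_comm hc.2.2.1]
    exact hB.combine hk (combinable_symm (fun _ => rfl) hc)
  · exact ⟨o, hA.combine hk' hc⟩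
  · exact absurd hc (hA.not_combinable hB)

/-- The system with the five initial tiles. -/
def system : System Glue Unit where
  strength _ := 1
  initial := Set.range fun k : Kind => single k.tile
  temperature := 1
  strength_pos _ := Nat.one_pos
  temperature_pos := Nat.one_pos
  initial_finite := Set.finite_range _
  support_nonempty := by
    rintro _ ⟨k, rfl⟩
    exact ⟨0, by simp [support, single]⟩
  support_finite := by
    rintro _ ⟨k, rfl⟩
    refine (Set.finite_singleton 0).subset fun p hp => ?_
    by_contra hne
    exact hp (if_neg hne)
  pending_empty := by
    rintro _ ⟨k, rfl⟩ p t ht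
    simp only [single] at ht
    split_ifs at ht
    obtain rfl : k.tile = t := by simpa using ht
    rfl
  glue_ne_off := by
    rintro _ ⟨k, rfl⟩ p t ht
    simp only [single] at ht
    split_ifs at ht
    obtain rfl : k.tile = t := by simpa using ht
    exact k.glue_ne_off

theorem singleAt_zero (k : Kind) : singleAt 0 k = single k.tile := by
  funext p
  simp [singleAt_apply, single]

theorem regular_of_finitelyProducible {A : Supertile Glue Unit}
    (h : system.FinitelyProducible A) : Regular A := by
  induction h with
  | base A hA =>
    obtain ⟨k, rfl⟩ := hA
    change Regular (single k.tile)
    rw [← singleAt_zero]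
    by_cases hk : k = .seed
    · subst hk
      exact .inr ⟨0, seeded_singleAt 0⟩
    · exact .inl ⟨0, k, hk, rfl⟩
  | combination A B v _ _ hc hA hB =>
    obtain ⟨o, ho⟩ := hA.combine (hB.translate v) hc
    exact .inr ⟨o, ho⟩
  | localStep A B _ hs hA =>
    rcases hA with ⟨q, k, hk, rfl⟩ | ⟨o, hA⟩
    · exact absurd hs not_localStep_singleAt
    · exact .inr ⟨o, hA.localStep hs⟩

theorem Seeded.step {o : ℤ × ℤ} {A A' : Supertile Glue Unit} (h : Seeded o A)
    (hs : system.Step A A') : Seeded o A' := by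
  rcases hs with hs | ⟨B, v, hB, hc, rfl⟩
  · exact h.localStep hs
  · rcases (regular_of_finitelyProducible hB).translate v with ⟨q, k, hk, hq⟩ | ⟨o', hB'⟩
    · rw [hq] at hc ⊢
      exact h.combine hk hc
    · exact absurd hc (h.not_combinable hB')

theorem Regular.step {A A' : Supertile Glue Unit} (h : Regular A)
    (hs : system.Step A A') : ∃ o, Seeded o A' := by
  rcases hs with hs | ⟨B, v, hB, hc, rfl⟩
  · rcases h with ⟨q, k, hk, rfl⟩ | ⟨o, hA⟩
    · exact absurd hs not_localStep_singleAt
    · exact ⟨o, hA.localStep hs⟩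
  · obtain ⟨o, ho⟩ := h.combine ((regular_of_finitelyProducible hB).translate v) hc
    exact ⟨o, ho⟩

/-- Each clause of `Seeded` concerns one position and its neighbours, where the sequence agrees with
its limit at a common late index. -/
theorem Seeded.of_limit {o : ℤ × ℤ} {α : ℕ → Supertile Glue Unit} {A : Supertile Glue Unit}
    (hα : ∀ᶠ n in Filter.atTop, Seeded o (α n))
    (hlim : ∀ p, ∀ᶠ n in Filter.atTop, α n p = A p) : Seeded o A := by
  have hloc : ∀ p, ∃ n, Seeded o (α n) ∧ α n p = A p ∧ ∀ d : Dir, α n (p + d.vec) = A (p + d.vec) :=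
    fun p => (hα.and ((hlim p).and (Filter.eventually_all.2 fun d => hlim _))).exists
  have hb : ∀ {n p}, α n p = A p → (∀ d : Dir, α n (p + d.vec) = A (p + d.vec)) → ∀ d g,
      (Bond (α n) (α n) p d g ↔ Bond A A p d g) := by
    intro n p h1 h2 d g
    simp only [Bond, glueAt_congr h1, glueAt_congr (h2 d)]
  refine ⟨fun x y t ht => ?_, fun p hp => ?_, ?_, fun x y hp d g hk => ?_⟩
  · obtain ⟨n, hn, h1, h2⟩ := hloc (pos o x y)
    exact (hn.evolved x y t (h1.trans ht)).congr (hb h1 h2)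
  · obtain ⟨n, hn, h1, -⟩ := hloc p
    exact hn.exists_pos p (by rwa [h1])
  · obtain ⟨n, hn, h1, -⟩ := hloc o
    rw [← h1]
    exact hn.seed
  · obtain ⟨n, hn, h1, h2⟩ := hloc (pos o x y)
    exact (hb h1 h2 d g).1 (hn.bond x y (by rwa [h1]) d g hk)

/-- Every step from a regular supertile produces a seeded one, and later steps keep the seed in
place. So either the sequence is eventually seeded with a fixed origin, or it never moves. -/
theorem regular_of_producible {A : Supertile Glue Unit} (h : system.Producible A) : Regular A := by
  obtain ⟨-, α, ⟨h0, hα⟩, hlim⟩ := h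
  have hlim' : ∀ p, ∀ᶠ n in Filter.atTop, α n p = A p := fun p => Filter.eventually_atTop.2 (hlim p)
  by_cases hs : ∃ n o, Seeded o (α n)
  · obtain ⟨n, o, hn⟩ := hs
    refine .inr ⟨o, Seeded.of_limit (Filter.eventually_atTop.2 ⟨n, fun m hm => ?_⟩) hlim'⟩
    induction m, hm using Nat.le_induction with
    | base => exact hn
    | succ m _ ih =>
      rcases hα m with h1 | h1
      · rwa [h1]
      · exact ih.step h1
  · have hconst : ∀ n, α n = α 0 ∧ Regular (α n) := by
      intro n
      induction n with
      | zero => exact ⟨rfl, regular_of_finitelyProducible h0⟩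
      | succ n ih =>
        rcases hα n with h1 | h1
        · rwa [h1]
        · obtain ⟨o, ho⟩ := ih.2.step h1
          exact absurd ⟨n + 1, o, ho⟩ hs
    have : A = α 0 := by
      funext p
      obtain ⟨N, hN⟩ := hlim p
      rw [← hN N le_rfl, (hconst N).1]
    rw [this]
    exact (hconst 0).2

/-! ### Executing pending actions along an assembly sequence. -/

/-- Execute an on request. -/
def exec (t : Tile Glue Unit) : Action Glue Unit → Tile Glue Unit
  | .glue d g _ => t.setGlue d g .on
  | .label x _ => t.setLabel x .on

/-- Execute a list of on requests, after which nothing is pending. -/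
def settle (t : Tile Glue Unit) (L : List (Action Glue Unit)) : Tile Glue Unit :=
  { L.foldl exec t with pending := 0 }

theorem settle_pending (t : Tile Glue Unit) (M : Multiset (Action Glue Unit))
    (L : List (Action Glue Unit)) : settle { t with pending := M } L = settle t L := by
  have : L.foldl exec { t with pending := M } = { L.foldl exec t with pending := M } := by
    induction L generalizing t with
    | nil => rfl
    | cons a L ih =>
      have ha : exec { t with pending := M } a = { exec t a with pending := M } := by
        cases a <;> rfl
      rw [List.foldl_cons, ha, ih, List.foldl_cons]
  simp [settle, this]

theorem settle_trans (t : Tile Glue Unit) (L : List (Action Glue Unit)) :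
    (settle t L).trans = t.trans := by
  change (L.foldl exec t).trans = t.trans
  induction L generalizing t with
  | nil => rfl
  | cons a L ih =>
    rw [List.foldl_cons, ih]
    cases a <;> rfl

/-- The action can be executed by the tile `t` at `p` without creating a bond. -/
def Ready (A : Supertile Glue Unit) (p : ℤ × ℤ) (t : Tile Glue Unit) : Action Glue Unit → Prop
  | .glue d g q => q = .on ∧ (t.glue d g = some .latent ∨ t.glue d g = some .on) ∧
      A.glueAt (p + d.vec) d.opp g ≠ some .on
  | .label x q => q = .on ∧ t.label x = some .latent

theorem step_exec {A : Supertile Glue Unit} {p : ℤ × ℤ} {t : Tile Glue Unit}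
    {a : Action Glue Unit} {M : Multiset (Action Glue Unit)} (ht : A p = some t)
    (hp : t.pending = a ::ₘ M) (ha : Ready A p t a) :
    system.Step A (Function.update A p (some { exec t a with pending := M })) := by
  left
  cases a with
  | glue d g q =>
    obtain ⟨rfl, hs, hn⟩ := ha
    rcases hs with hs | hs
    · have h := LocalStep.glue_activate (strength := system.strength)
        (τ := system.temperature) A p t d g M ht hp hs
      rwa [fireBond_of_not] at h
      rintro ⟨-, h2⟩
      rw [glueAt_congr (B := A) (by simp [d.vec_ne_zero])] at h2
      exact hn h2
    · exact LocalStep.glue_other (strength := system.strength)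
        (τ := system.temperature) A p t d g .on .on M ht hp hs (by simp)
  | label x q =>
    obtain ⟨rfl, hs⟩ := ha
    exact LocalStep.label (strength := system.strength)
        (τ := system.temperature) A p t x .on _ M ht hp hs

/-- An assembly sequence leads from `A` to `B` in at most `k` steps, all of which change only
position `p`. -/
def Path (p : ℤ × ℤ) (A B : Supertile Glue Unit) (k : ℕ) : Prop :=
  ∃ β : ℕ → Supertile Glue Unit, β 0 = A ∧ (∀ j ≥ k, β j = B) ∧
    (∀ j, β (j + 1) = β j ∨ system.Step (β j) (β (j + 1))) ∧ ∀ j, ∀ q ≠ p, β j q = A q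

theorem Path.refl (p : ℤ × ℤ) (A : Supertile Glue Unit) : Path p A A 0 :=
  ⟨fun _ => A, rfl, fun _ _ => rfl, fun _ => .inl rfl, fun _ _ _ => rfl⟩

theorem Path.cons {p : ℤ × ℤ} {A B : Supertile Glue Unit} {o : Option (Tile Glue Unit)} {k : ℕ}
    (hs : system.Step A (Function.update A p o)) (h : Path p (Function.update A p o) B k) :
    Path p A B (k + 1) := by
  obtain ⟨β, h0, h1, h2, h3⟩ := h
  refine ⟨fun j => Nat.casesOn j A β, rfl, fun j hj => ?_, fun j => ?_, fun j q hq => ?_⟩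
  · rcases j with _ | j
    · omega
    · exact h1 j (by omega)
  · rcases j with _ | j
    · right
      change system.Step A (β 0)
      rwa [h0]
    · exact h2 j
  · rcases j with _ | j
    · rfl
    · change β j q = A q
      rw [h3 j q hq, Function.update_of_ne hq]

theorem Path.mono {p : ℤ × ℤ} {A B : Supertile Glue Unit} {k l : ℕ} (h : Path p A B k)
    (hkl : k ≤ l) : Path p A B l := by
  obtain ⟨β, h0, h1, h2⟩ := h
  exact ⟨β, h0, fun j hj => h1 j (hkl.trans hj), h2⟩

theorem path_exec {p : ℤ × ℤ} (L : List (Action Glue Unit)) : ∀ {A : Supertile Glue Unit}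
    {t : Tile Glue Unit}, A p = some t → t.pending = L → (∀ a ∈ L, Ready A p t a) → L.Nodup →
    Path p A (Function.update A p (some (settle t L))) L.length := by
  induction L with
  | nil =>
    intro A t ht hp _ _
    have : settle t [] = t := by
      cases t
      simp only [Multiset.coe_nil] at hp
      subst hp
      rfl
    rw [this, ← ht, Function.update_eq_self]
    exact Path.refl p A
  | cons a L ih =>
    intro A t ht hp hr hnd
    rw [← Multiset.cons_coe] at hp
    refine Path.cons (step_exec ht hp (hr a (by simp))) ?_
    have h := ih (A := Function.update A p (some { exec t a with pending := L }))
      (Function.update_self ..) rfl ?_ (List.nodup_cons.1 hnd).2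
    · rw [Function.update_idem, settle_pending] at h
      exact h
    · intro b hb
      have hbr := hr b (by simp [hb])
      cases b with
      | glue d g q =>
        obtain ⟨hq, hs, hn⟩ := hbr
        refine ⟨hq, ?_, ?_⟩
        · cases a with
          | label x r => exact hs
          | glue e k r =>
            by_cases hd : d = e
            · subst hd
              -- If the previous action concerned this very glue, it is now on, which `Ready` also
              -- allows.
              by_cases hg : g = k
              · simp [exec, Tile.setGlue, hg]
              · simpa [exec, Tile.setGlue, hg] using hs
            · simpa [exec, Tile.setGlue, hd] using hs
        · rw [glueAt_congr (B := A) (by simp [d.vec_ne_zero])]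
          exact hn
      | label x q =>
        obtain ⟨rfl, hs⟩ := hbr
        refine ⟨rfl, ?_⟩
        cases a with
        | glue d g r => exact hs
        | label z r =>
          obtain ⟨rfl, -⟩ := hr (.label z r) (by simp)
          -- There is only one label, so a second label request would be the same action, contrary
          -- to `Nodup`.
          exact absurd hb (List.nodup_cons.1 hnd).1

theorem combinable_of_glueAt {A : Supertile Glue Unit} (hA : Regular A) {q : ℤ × ℤ}
    (hq : A q = none) {k : Kind} {d : Dir} {g : Glue} (hk : k.input = some (d, g))
    (hg : A.glueAt (q + d.vec) d.opp g = some .on) :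
    Combinable (fun _ => 1) 1 A (singleAt q k) := by
  refine ⟨hA.stable, singleAt_stable q k, ?_, (bondStrengthGE_one_iff fun _ => rfl).2 ?_⟩
  · rw [Set.disjoint_left]
    intro p hp hs
    obtain rfl := singleAt_ne_none.1 hs
    exact hp hq
  · refine ⟨_, _, _, hg, ?_⟩
    rw [Dir.opp_opp, Dir.vec_opp, add_neg_cancel_right, glueAt_singleAt]
    exact ⟨rfl, Kind.glue_input hk⟩

theorem Kind.ne_seed {k : Kind} {d : Dir} {g : Glue} (hk : k.input = some (d, g)) : k ≠ .seed := by
  rintro rfl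
  simp [Kind.input] at hk

/-- The new tile binds by its input only, and its partner binds on an eastern or northern side,
where bonds request nothing. So only the new tile receives pending actions. -/
theorem combine_singleAt {A : Supertile Glue Unit} {q : ℤ × ℤ} (hq : A q = none)
    (htrans : ∀ p t, A p = some t → ∀ g, t.trans .east g = ∅ ∧ t.trans .north g = ∅)
    {k : Kind} {d : Dir} {g : Glue} (hk : k.input = some (d, g))
    (hg : A.glueAt (q + d.vec) d.opp g = some .on) :
    A.combine (singleAt q k) =
      Function.update A q (some { k.tile with pending := k.requests d g }) := by
  have hk' := Kind.ne_seed hk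
  funext p
  by_cases hp : p = q
  · subst hp
    have hb : ∀ e l, Bond (singleAt p k) A p e l ↔ e = d ∧ l = g := by
      intro e l
      constructor
      · rintro ⟨h1, -⟩
        have := Kind.input_of_on hk' (glueAt_singleAt.1 h1).2
        simpa [hk, eq_comm] using this
      · rintro ⟨rfl, rfl⟩
        exact ⟨glueAt_singleAt.2 ⟨rfl, Kind.glue_input hk⟩, hg⟩
    have hreq : requested (singleAt p k) A p k.tile = k.requests d g := by
      rw [requested, Finset.sum_eq_single d, Finset.sum_eq_single g]
      · rw [if_pos ((hb d g).2 ⟨rfl, rfl⟩)]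
        rfl
      · intro l _ hl
        exact if_neg fun h => hl ((hb d l).1 h).2
      · simp
      · intro e _ he
        exact Finset.sum_eq_zero fun l _ => if_neg fun h => he ((hb e l).1 h).1
      · simp
    have hfire : (singleAt p k).fire A p =
        some (k.tile.addPending (requested (singleAt p k) A p k.tile)) := by
      simp [fire, singleAt_apply, requested]
    rw [combine_of_right hq, hfire, hreq, Function.update_self]
    simp [Tile.addPending, Kind.tile]
  · rw [Function.update_of_ne hp]
    cases hA : A p with
    | none => simp [combine_of_right hA, fire, singleAt_apply, hp]
    | some t =>
      have : requested A (singleAt q k) p t = 0 := by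
        rw [requested]
        refine Finset.sum_eq_zero fun e _ => Finset.sum_eq_zero fun l _ => ?_
        split_ifs with hb
        · have hi := Kind.input_side (Kind.input_of_on hk' (glueAt_singleAt.1 hb.2).2)
          cases e <;> simp [Dir.opp] at hi
          · simp [(htrans p t hA l).2]
          · simp [(htrans p t hA l).1]
        · rfl
      rw [combine_of_left hA, this]
      simp [Tile.addPending]

/-! ### An explicit assembly sequence filling the quadrant. -/

/-- All the actions that a tile whose southern neighbour has the value `u` executes. -/
def Kind.actions (u : Bool) : Kind → List (Action Glue Unit)
  | .seed => []
  | .xAxis => Kind.xAxis.requests .west .x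
  | .yAxis => Kind.yAxis.requests .south .y
  | .inner b => [.glue .south (.v (!u) b) .on, .glue .south (.v u b) .on] ++
      (Kind.inner b).requests .south (.v u b)

/-- The final state of a tile whose southern neighbour has the value `u`. -/
def Kind.final (k : Kind) (u : Bool) : Tile Glue Unit := settle k.tile (k.actions u)

/-- The final state of the tile at `(x, y)`. -/
def final (x y : ℕ) : Tile Glue Unit := (kind x y).final (val x (y - 1))

theorem final_trans (x y : ℕ) (g : Glue) :
    (final x y).trans .east g = ∅ ∧ (final x y).trans .north g = ∅ := by
  have h : (final x y).trans = (kind x y).tile.trans := settle_trans ..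
  rw [h]
  constructor <;> refine Finset.eq_empty_of_forall_notMem fun a ha => ?_
  · rw [Kind.mem_trans, Kind.requests_east] at ha
    simp at ha
  · rw [Kind.mem_trans, Kind.requests_north] at ha
    simp at ha

theorem Kind.final_output (u b e : Bool) :
    (Kind.seed.final u).glue .east .x = some .on ∧
    (Kind.seed.final u).glue .north .y = some .on ∧
    (Kind.xAxis.final u).glue .east .x = some .on ∧
    (Kind.xAxis.final u).glue .north (.v true e) = some .on ∧
    (Kind.yAxis.final u).glue .north .y = some .on ∧
    (Kind.yAxis.final u).glue .east (.w true) = some .on ∧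
    ((Kind.inner b).final u).glue .east (.w (xor u b)) = some .on ∧
    ((Kind.inner b).final u).glue .north (.v (xor u b) e) = some .on := by
  revert u b e; decide

theorem Kind.final_output_inv (u b c e : Bool) :
    ((Kind.xAxis.final u).glue .north (.v c e) = some .on → c = true) ∧
    (((Kind.inner b).final u).glue .north (.v c e) = some .on → c = xor u b) := by
  revert u b c e; decide

theorem final_east_x (x : ℕ) : (final x 0).glue .east .x = some .on := by
  rcases x with _ | x
  · exact (Kind.final_output _ true true).1
  · exact (Kind.final_output _ true true).2.2.1

theorem final_north_y (y : ℕ) : (final 0 y).glue .north .y = some .on := by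
  rcases y with _ | y
  · exact (Kind.final_output _ true true).2.1
  · exact (Kind.final_output _ true true).2.2.2.2.1

theorem final_east_w (x y : ℕ) : (final x (y + 1)).glue .east (.w (val x (y + 1))) = some .on := by
  rcases x with _ | x
  · rw [val_zero_left]
    exact (Kind.final_output _ true true).2.2.2.2.2.1
  · rw [val_succ_succ]
    exact (Kind.final_output _ _ true).2.2.2.2.2.2.1

theorem final_north_v (x y : ℕ) (e : Bool) :
    (final (x + 1) y).glue .north (.v (val (x + 1) y) e) = some .on := by
  rcases y with _ | y
  · rw [val_zero_right]
    exact (Kind.final_output _ true e).2.2.2.1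
  · rw [val_succ_succ]
    exact (Kind.final_output _ _ e).2.2.2.2.2.2.2

theorem eq_val_of_final_north {x y : ℕ} {c e : Bool}
    (h : (final (x + 1) y).glue .north (.v c e) = some .on) : c = val (x + 1) y := by
  rcases y with _ | y
  · rw [val_zero_right]
    exact (Kind.final_output_inv _ true c e).1 h
  · rw [val_succ_succ]
    exact (Kind.final_output_inv _ _ c e).2 h

/-- The supertile of the first `n` final tiles, in the order given by `Nat.pair`. -/
def stage (n : ℕ) : Supertile Glue Unit := fun p =>
  if (0 ≤ p.1 ∧ 0 ≤ p.2) ∧ Nat.pair p.1.toNat p.2.toNat < n then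
    some (final p.1.toNat p.2.toNat) else none

/-- The supertile of all final tiles. -/
def full : Supertile Glue Unit := fun p =>
  if 0 ≤ p.1 ∧ 0 ≤ p.2 then some (final p.1.toNat p.2.toNat) else none

theorem stage_pos (n x y : ℕ) :
    stage n (pos 0 x y) = if Nat.pair x y < n then some (final x y) else none := by
  simp [stage, pos]

theorem full_pos (x y : ℕ) : full (pos 0 x y) = some (final x y) := by
  simp [full, pos]

theorem exists_pos_zero {p : ℤ × ℤ} (h : 0 ≤ p.1 ∧ 0 ≤ p.2) : ∃ x y, p = pos 0 x y :=
  ⟨p.1.toNat, p.2.toNat, by ext <;> simp [pos, h.1, h.2]⟩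

theorem stage_eq_some {n : ℕ} {p : ℤ × ℤ} {t : Tile Glue Unit} (h : stage n p = some t) :
    ∃ x y, p = pos 0 x y ∧ t = final x y := by
  have hp : 0 ≤ p.1 ∧ 0 ≤ p.2 := by
    by_contra hp
    simp [stage, hp] at h
  obtain ⟨x, y, rfl⟩ := exists_pos_zero hp
  rw [stage_pos] at h
  split_ifs at h
  exact ⟨x, y, rfl, by simpa using h.symm⟩

theorem stage_succ (x y : ℕ) : stage (Nat.pair x y + 1) =
    Function.update (stage (Nat.pair x y)) (pos 0 x y) (some (final x y)) := by
  funext p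
  by_cases hp : 0 ≤ p.1 ∧ 0 ≤ p.2
  · obtain ⟨x', y', rfl⟩ := exists_pos_zero hp
    by_cases he : pos 0 x' y' = pos 0 x y
    · rw [he, Function.update_self, stage_pos]
      simp
    · rw [Function.update_of_ne he, stage_pos, stage_pos]
      have : Nat.pair x' y' ≠ Nat.pair x y := by
        intro h
        obtain ⟨rfl, rfl⟩ := Nat.pair_eq_pair.1 h
        exact he rfl
      have : Nat.pair x' y' < Nat.pair x y + 1 ↔ Nat.pair x' y' < Nat.pair x y := by omega
      simp only [this]
  · have he : p ≠ pos 0 x y := by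
      rintro rfl
      exact hp (by simp [pos])
    rw [Function.update_of_ne he]
    simp [stage, hp]

theorem stage_self (x y : ℕ) : stage (Nat.pair x y) (pos 0 x y) = none := by
  simp [stage_pos]

theorem glueAt_stage {n x y : ℕ} (h : Nat.pair x y < n) (d : Dir) (g : Glue) :
    (stage n).glueAt (pos 0 x y) d g = (final x y).glue d g :=
  glueAt_of_eq (by rw [stage_pos, if_pos h]) d g

/-- `Nat.pair` is strictly increasing in each argument, so the western and southern neighbours come
earlier in the order and are already final. -/
theorem glueAt_stage_input {x y : ℕ} {d : Dir} {g : Glue} (h : (kind x y).input = some (d, g)) :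
    (stage (Nat.pair x y)).glueAt (pos 0 x y + d.vec) d.opp g = some .on := by
  rcases x with _ | x <;> rcases y with _ | y <;>
    simp only [kind, Kind.input, Option.some.injEq, Prod.mk.injEq, reduceCtorEq] at h <;>
    obtain ⟨rfl, rfl⟩ := h
  · rw [pos_south, glueAt_stage (Nat.pair_lt_pair_right _ (Nat.lt_succ_self _))]
    exact final_north_y y
  · rw [pos_west, glueAt_stage (Nat.pair_lt_pair_left _ (Nat.lt_succ_self _))]
    exact final_east_x x
  · rw [pos_west, glueAt_stage (Nat.pair_lt_pair_left _ (Nat.lt_succ_self _))]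
    exact final_east_w x y

theorem glueAt_stage_output {x y : ℕ} {d : Dir} (hd : d = .east ∨ d = .north) (e : Dir) (g : Glue) :
    (stage (Nat.pair x y)).glueAt (pos 0 x y + d.vec) e g = none := by
  have : stage (Nat.pair x y) (pos 0 x y + d.vec) = none := by
    rcases hd with rfl | rfl
    · rw [pos_east, stage_pos, if_neg]
      exact (Nat.pair_lt_pair_left _ (Nat.lt_succ_self _)).not_gt
    · rw [pos_north, stage_pos, if_neg]
      exact (Nat.pair_lt_pair_right _ (Nat.lt_succ_self _)).not_gt
  simp [glueAt, this]

theorem finitelyProducible_single (k : Kind) : system.FinitelyProducible (single k.tile) :=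
  .base _ ⟨k, rfl⟩

theorem step_attach {x y : ℕ} (hA : Regular (stage (Nat.pair x y))) {d : Dir} {g : Glue}
    (h : (kind x y).input = some (d, g)) :
    system.Step (stage (Nat.pair x y)) (Function.update (stage (Nat.pair x y)) (pos 0 x y)
      (some { (kind x y).tile with pending := (kind x y).requests d g })) := by
  refine .inr ⟨single (kind x y).tile, pos 0 x y, finitelyProducible_single _,
    combinable_of_glueAt hA (stage_self x y) h (glueAt_stage_input h), ?_⟩
  refine (combine_singleAt (stage_self x y) (fun p t ht g => ?_) h (glueAt_stage_input h)).symm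
  obtain ⟨x', y', -, rfl⟩ := stage_eq_some ht
  exact final_trans x' y' g

theorem ready_update {A : Supertile Glue Unit} {p : ℤ × ℤ} {t : Tile Glue Unit}
    {o : Option (Tile Glue Unit)} {a : Action Glue Unit} (h : Ready A p t a) :
    Ready (Function.update A p o) p t a := by
  cases a with
  | glue d g q =>
    obtain ⟨h1, h2, h3⟩ := h
    refine ⟨h1, h2, ?_⟩
    rwa [glueAt_congr (B := A) (by simp [d.vec_ne_zero])]
  | label x q => exact h

/-- Only the input bond of an axis tile makes requests, and its outputs face empty positions, so
they can be executed in the listed order without forming bonds. -/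
theorem path_stage_axis {x y : ℕ} (hA : Regular (stage (Nat.pair x y)))
    {d : Dir} {g : Glue} (h : (kind x y).input = some (d, g))
    (hact : ∀ u, (kind x y).actions u = (kind x y).requests d g)
    (hlat : ∀ a ∈ (kind x y).requests d g, ∃ e l, a = .glue e l .on ∧ (e = .east ∨ e = .north) ∧
      (kind x y).glue e l = some .latent) (hlen : ((kind x y).requests d g).length ≤ 6) :
    Path (pos 0 x y) (stage (Nat.pair x y)) (stage (Nat.pair x y + 1)) 7 := by
  refine Path.mono (Path.cons (step_attach hA h) (?_ : Path _ _ _ _)) (Nat.succ_le_succ hlen)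
  have := path_exec ((kind x y).requests d g) (p := pos 0 x y) (A := Function.update
    (stage (Nat.pair x y)) (pos 0 x y)
    (some { (kind x y).tile with pending := (kind x y).requests d g }))
    (Function.update_self ..) rfl (fun a ha => ?_) (Kind.requests_nodup ..)
  · rw [Function.update_idem, settle_pending] at this
    rw [stage_succ, final, Kind.final, hact]
    exact this
  · obtain ⟨e, l, rfl, he, hl⟩ := hlat a ha
    refine ready_update ⟨rfl, .inl hl, ?_⟩
    simp [glueAt_stage_output he]

/-- Seven steps suffice: the attachment, two southern activations, three outputs and possibly the
label. The wrong southern guess is activated first, so that the second activation forms the only new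
bond and releases the outputs. -/
theorem path_stage_inner {x y : ℕ} (hA : Regular (stage (Nat.pair (x + 1) (y + 1)))) :
    Path (pos 0 (x + 1) (y + 1)) (stage (Nat.pair (x + 1) (y + 1)))
      (stage (Nat.pair (x + 1) (y + 1) + 1)) 7 := by
  have hin : (kind (x + 1) (y + 1)).input = some (.west, .w (val x (y + 1))) := rfl
  have hstep := step_attach hA hin
  rw [stage_succ]
  have hbelow : ∀ c, (stage (Nat.pair (x + 1) (y + 1))).glueAt
      (pos 0 (x + 1) (y + 1) + Dir.south.vec) .north (.v c (val x (y + 1))) = some .on ↔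
      c = val (x + 1) y := by
    intro c
    rw [pos_south, glueAt_stage (Nat.pair_lt_pair_right _ (Nat.lt_succ_self _))]
    exact ⟨eq_val_of_final_north, by rintro rfl; exact final_north_v ..⟩
  have htrans : ∀ t, stage (Nat.pair (x + 1) (y + 1)) (pos 0 (x + 1) (y + 1) + Dir.south.vec) =
      some t → ∀ g, t.trans .north g = ∅ := by
    intro t ht g
    obtain ⟨x', y', -, rfl⟩ := stage_eq_some ht
    exact (final_trans x' y' g).2
  have hout : ∀ {d : Dir}, (d = .east ∨ d = .north) → ∀ e g, (stage (Nat.pair (x + 1) (y + 1))).glueAt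
      (pos 0 (x + 1) (y + 1) + d.vec) e g = none := fun hd e g => glueAt_stage_output hd e g
  have hfin : final (x + 1) (y + 1) =
    (Kind.inner (val x (y + 1))).final (val (x + 1) y) := rfl
  rw [hfin]
  simp only [kind] at hstep
  generalize stage (Nat.pair (x + 1) (y + 1)) = A at *
  generalize pos 0 (x + 1) (y + 1) = p at *
  generalize val x (y + 1) = b at *
  generalize val (x + 1) y = u at *
  have hps : p + Dir.south.vec ≠ p := by simpa using Dir.south.vec_ne_zero
  refine Path.cons hstep ?_
  -- Pending actions are unordered, so the wrong guess may be listed first whatever `u` is.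
  have hreq : ((Kind.inner b).requests .west (.w b) : Multiset (Action Glue Unit)) =
      .glue .south (.v (!u) b) .on ::ₘ {.glue .south (.v u b) .on} := by
    simp only [Kind.requests, if_true]
    cases u
    · exact Multiset.cons_swap _ _ 0
    · rfl
  rw [hreq]
  set t₁ : Tile Glue Unit := { (Kind.inner b).tile with
    pending := .glue .south (.v (!u) b) .on ::ₘ {.glue .south (.v u b) .on} } with ht₁
  have hstep₁ := step_exec (A := Function.update A p (some t₁)) (Function.update_self ..)
    (t := t₁) (a := .glue .south (.v (!u) b) .on)
    (M := {.glue .south (.v u b) .on}) rfl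
    (ready_update (A := A) ⟨rfl, .inl (by simp [t₁, Kind.tile, Kind.glue]), by
      rw [Dir.opp, Ne, hbelow]
      simp⟩)
  refine Path.cons hstep₁ ?_
  rw [Function.update_idem]
  set t₂ : Tile Glue Unit :=
    { exec t₁ (.glue .south (.v (!u) b) .on) with pending := {.glue .south (.v u b) .on} } with ht₂
  have hs₂ : t₂.glue .south (.v u b) = some .latent := by
    simp [t₂, exec, Tile.setGlue, t₁, Kind.tile, Kind.glue]
  set t₃ : Tile Glue Unit :=
    { t₂.setGlue .south (.v u b) .on with pending := (Kind.inner b).requests .south (.v u b) }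
    with ht₃
  have hstep₂ : system.Step (Function.update A p (some t₂))
      (Function.update (Function.update A p (some t₂)) p (some t₃)) := by
    have h := LocalStep.glue_activate (strength := system.strength) (τ := system.temperature)
      (Function.update A p (some t₂)) p t₂ .south (.v u b) 0 (Function.update_self ..) rfl hs₂
    rw [Function.update_idem] at h ⊢
    rw [fireBond_of_bond] at h
    · left
      convert h using 1
      funext q
      by_cases hq : q = p
      · subst hq
        simp only [Function.update_self, addPendingAt_apply, hps.symm, if_false, if_true,
          Option.map_some, transAt, Option.elim_some]
        simp only [Tile.addPending, zero_add]
        rfl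
      · by_cases hq' : q = p + Dir.south.vec
        · subst hq'
          simp only [addPendingAt_apply, Function.update_of_ne hps, hps, if_false, if_true, transAt,
            Option.map_map]
          cases hA' : A (p + Dir.south.vec) with
          | none => rfl
          | some t => simp [Dir.opp, htrans t hA', Tile.addPending]
        · simp only [addPendingAt_apply, Function.update_of_ne hq, hq, hq', if_false]
          cases A q <;> rfl
    · refine ⟨by simp [glueAt, Tile.setGlue], ?_⟩
      rw [glueAt_congr (B := A) (Function.update_of_ne hps _ _)]
      exact (hbelow u).2 rfl
  refine Path.cons hstep₂ ?_
  rw [Function.update_idem]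
  have hpath := path_exec ((Kind.inner b).requests .south (.v u b)) (p := p)
    (A := Function.update A p (some t₃)) (t := t₃) (Function.update_self ..) rfl ?_
    (Kind.requests_nodup ..)
  · rw [Function.update_idem] at hpath
    have hset : settle t₃ ((Kind.inner b).requests .south (.v u b)) = (Kind.inner b).final u := by
      rw [ht₃, settle_pending]
      change _ = settle (exec (exec (Kind.inner b).tile _) _) _
      rw [show t₂.setGlue .south (.v u b) .on = exec t₂ (.glue .south (.v u b) .on) from rfl, ht₂]
      rw [← settle_pending (exec (exec (Kind.inner b).tile _) _) {.glue .south (.v u b) .on}]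
      rfl
    rw [hset] at hpath
    refine hpath.mono (?_ : _ ≤ 4)
    simp only [Kind.requests, if_true, List.length_append, List.length_cons, List.length_nil]
    split_ifs <;> simp
  · have hg : ∀ d, (d = .east ∨ d = .north) → ∀ g, t₃.glue d g = (Kind.inner b).glue d g := by
      rintro d (rfl | rfl) g <;> simp [t₃, t₂, t₁, exec, Tile.setGlue, Kind.tile]
    have hready : ∀ d g, (d = .east ∨ d = .north) → (Kind.inner b).glue d g = some .latent →
        Ready A p t₃ (.glue d g .on) := by
      intro d g hd hl
      exact ⟨rfl, .inl (by rw [hg d hd, hl]), by simp [hout hd]⟩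
    intro a ha
    refine ready_update ?_
    simp only [Kind.requests, if_true, List.mem_append, List.mem_cons, List.not_mem_nil,
      or_false] at ha
    rcases ha with (rfl | rfl | rfl) | ha
    · exact hready _ _ (.inl rfl) rfl
    · exact hready _ _ (.inr rfl) rfl
    · exact hready _ _ (.inr rfl) rfl
    · split_ifs at ha
      · obtain rfl : a = .label () .on := by simpa using ha
        exact ⟨rfl, rfl⟩
      · simp at ha

theorem path_stage {n : ℕ} (hn : n ≠ 0) (hA : Regular (stage n)) :
    Path (pos 0 n.unpair.1 n.unpair.2) (stage n) (stage (n + 1)) 7 := by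
  obtain ⟨x, y, rfl⟩ : ∃ x y, Nat.pair x y = n := ⟨_, _, Nat.pair_unpair n⟩
  rw [Nat.unpair_pair]
  rcases x with _ | x <;> rcases y with _ | y
  · simp [Nat.pair] at hn
  · refine path_stage_axis hA (d := .south) (g := .y) rfl (fun _ => rfl) ?_
      (by simp [kind, Kind.requests])
    intro a ha
    simp only [kind, Kind.requests, List.mem_cons, List.not_mem_nil, or_false] at ha
    rcases ha with rfl | rfl
    · exact ⟨_, _, rfl, .inr rfl, rfl⟩
    · exact ⟨_, _, rfl, .inl rfl, rfl⟩
  · refine path_stage_axis hA (d := .west) (g := .x) rfl (fun _ => rfl) ?_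
      (by simp [kind, Kind.requests])
    intro a ha
    simp only [kind, Kind.requests, List.mem_cons, List.not_mem_nil, or_false] at ha
    rcases ha with rfl | rfl | rfl
    · exact ⟨_, _, rfl, .inl rfl, rfl⟩
    · exact ⟨_, _, rfl, .inr rfl, rfl⟩
    · exact ⟨_, _, rfl, .inr rfl, rfl⟩
  · exact path_stage_inner hA

theorem finitelyProducible_step {A B : Supertile Glue Unit} (hA : system.FinitelyProducible A)
    (h : system.Step A B) : system.FinitelyProducible B := by
  rcases h with h | ⟨C, v, hC, hc, rfl⟩
  · exact .localStep A B hA h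
  · exact .combination A C v hA hC hc

theorem Path.finitelyProducible {p : ℤ × ℤ} {A B : Supertile Glue Unit} {k : ℕ}
    (h : Path p A B k) (hA : system.FinitelyProducible A) : system.FinitelyProducible B := by
  obtain ⟨β, h0, h1, h2, -⟩ := h
  rw [← h1 k le_rfl]
  generalize k = j
  induction j with
  | zero => rwa [h0]
  | succ j ih =>
    rcases h2 j with h | h
    · rwa [h]
    · exact finitelyProducible_step ih h

theorem finitelyProducible_stage (n : ℕ) : system.FinitelyProducible (stage (n + 1)) := by
  induction n with
  -- `stage 0` is empty; the assembly starts with `stage 1`, which is the seed alone.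
  | zero =>
    convert finitelyProducible_single .seed using 1
    have h := stage_succ 0 0
    have h0 : Nat.pair 0 0 = 0 := rfl
    rw [h0, pos_zero] at h
    rw [h]
    funext p
    by_cases hp : p = 0
    · subst hp
      rw [Function.update_self]
      rfl
    · rw [Function.update_of_ne hp]
      simp [stage, single, hp]
  | succ n ih =>
    exact (path_stage n.succ_ne_zero (regular_of_finitelyProducible ih)).finitelyProducible ih

/-- Each new tile gets a block of seven time slots, padded by idle steps: time `m` is slot `m % 7`
of block `m / 7`. A block changes only the position of its own tile, so every position stabilizes.
-/
theorem producible_full : system.Producible full := by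
  refine ⟨⟨0, by simp [support, full]⟩, ?_⟩
  choose β h0 h1 h2 h3 using fun n : ℕ => path_stage n.succ_ne_zero
    (regular_of_finitelyProducible (finitelyProducible_stage n))
  refine ⟨fun m => β (m / 7) (m % 7), ⟨?_, fun m => ?_⟩, fun p => ?_⟩
  · simp only [Nat.zero_div, Nat.zero_mod, h0]
    exact finitelyProducible_stage 0
  · by_cases hm : m % 7 = 6
    · have e1 : (m + 1) / 7 = m / 7 + 1 := by omega
      have e2 : (m + 1) % 7 = 0 := by omega
      simp only [e1, e2, h0, hm]
      have := h2 (m / 7) 6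
      rwa [h1 _ 7 le_rfl] at this
    · have e1 : (m + 1) / 7 = m / 7 := by omega
      have e2 : (m + 1) % 7 = m % 7 + 1 := by omega
      simp only [e1, e2]
      exact h2 _ _
  · by_cases hp : 0 ≤ p.1 ∧ 0 ≤ p.2
    · obtain ⟨x, y, rfl⟩ := exists_pos_zero hp
      -- Block `n` starts at `stage (n + 1)`, so the tile of index `Nat.pair x y` is complete when
      -- the preceding block ends, which is at this time.
      refine ⟨7 * Nat.pair x y, fun m hm => ?_⟩
      have hlt : Nat.pair x y < m / 7 + 1 := by omega
      change β (m / 7) (m % 7) _ = _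
      rw [h3 _ _ _ ?_, stage_pos, if_pos hlt, full_pos]
      intro he
      obtain ⟨h, h'⟩ := pos_inj he
      rw [h, h', Nat.pair_unpair] at hlt
      exact lt_irrefl _ hlt
    · refine ⟨0, fun m _ => ?_⟩
      change β (m / 7) (m % 7) _ = _
      rw [h3 _ _ _ ?_]
      · simp [stage, full, hp]
      · rintro rfl
        exact hp (by simp [pos])

theorem full_ne_none_add {p : ℤ × ℤ} (hp : full p ≠ none) {d : Dir} (hd : d = .east ∨ d = .north) :
    full (p + d.vec) ≠ none := by
  have hp : 0 ≤ p.1 ∧ 0 ≤ p.2 := by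
    by_contra h
    simp [full, h] at hp
  obtain ⟨x, y, rfl⟩ := exists_pos_zero hp
  rcases hd with rfl | rfl
  · simp [pos_east, full_pos]
  · simp [pos_north, full_pos]

/-- A lone tile could only attach east or north of an occupied position, and in the full quadrant
those positions are occupied. Nothing is pending, and seeded supertiles do not combine. -/
theorem terminal_full : system.Terminal full := by
  have hreg := regular_of_producible producible_full
  refine ⟨producible_full, fun B v hB hc => ?_, fun A' hs => ?_⟩
  · obtain ⟨o, ho⟩ : ∃ o, Seeded o full := by
      rcases hreg with ⟨q, k, -, hq⟩ | h
      · have h1 : full (pos 0 0 0) ≠ none := by simp [full_pos]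
        have h2 : full (pos 0 1 0) ≠ none := by simp [full_pos]
        rw [hq, singleAt_ne_none] at h1 h2
        exact absurd (pos_inj (h1.trans h2.symm)).1 (by decide)
      · exact h
    rcases (regular_of_producible hB).translate v with ⟨q, k, hk, hq⟩ | ⟨o', ho'⟩
    · rw [hq] at hc
      obtain ⟨-, -, hd, hb⟩ := hc
      obtain ⟨p, d, g, hb⟩ := (bondStrengthGE_one_iff fun _ => rfl).1 hb
      obtain ⟨hdir, -, rfl, -⟩ := ho.exists_pos_of_bond hk hb
      have := eq_none_of_disjoint hd (full_ne_none_add (ne_none_of_glueAt hb.1) hdir)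
      simp [singleAt_apply] at this
    · exact ho.not_combinable ho' hc
  · have hpend : ∀ p t, full p = some t → t.pending = 0 := by
      intro p t ht
      simp only [full] at ht
      split_ifs at ht
      obtain rfl := Option.some.inj ht
      rfl
    cases hs with
    | break_apart X hX => exact hreg.stable X hX
    | glue_activate p t d g rest ht hp hs => simp [hpend p t ht] at hp
    | glue_other p t d g q s rest ht hp hs hne => simp [hpend p t ht] at hp
    | label p t x q s rest ht hp hs => simp [hpend p t ht] at hp

/-! ### The Sierpinski triangle as Pascal's triangle modulo 2. -/

open Polynomial in
theorem choose_add_two_pow (i m k : ℕ) : ((m + 2 ^ i).choose k).bodd =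
    xor (m.choose k).bodd (if 2 ^ i ≤ k then (m.choose (k - 2 ^ i)).bodd else false) := by
  -- By the Frobenius map in characteristic 2, `(X + 1) ^ 2 ^ i = X ^ 2 ^ i + 1`; the coefficients
  -- of `X ^ k` are compared.
  have h : ((X : (ZMod 2)[X]) + 1) ^ (m + 2 ^ i) = (X + 1) ^ m * X ^ 2 ^ i + (X + 1) ^ m := by
    rw [pow_add, add_pow_char_pow, one_pow, mul_add, mul_one]
  have h' := congrArg (fun q => coeff q k) h
  simp only [coeff_add, coeff_mul_X_pow', coeff_X_add_one_pow] at h'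
  have hb : ∀ a b : ℕ, (a : ZMod 2) = b → a.bodd = b.bodd := by
    intro a b hab
    have := (ZMod.natCast_eq_natCast_iff' a b 2).1 hab
    rw [Nat.mod_two_of_bodd, Nat.mod_two_of_bodd] at this
    cases ha : a.bodd <;> cases hb : b.bodd <;> simp_all
  split_ifs at h' ⊢ with hk
  · rw [Bool.xor_comm, ← Nat.bodd_add]
    exact hb _ _ (by exact_mod_cast h')
  · rw [Bool.xor_false]
    exact hb _ _ (by simpa using h')

/-- Modulo 2, rows `2 ^ i` to `2 ^ (i + 1) - 1` of Pascal's triangle are two copies of the rows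
above them, shifted along either axis, with zeros between the copies. -/
theorem mem_sierpinskiStage (i : ℕ) (p : ℤ × ℤ) : p ∈ sierpinskiStage i ↔
    ∃ x y : ℕ, p = ((x : ℤ), (y : ℤ)) ∧ x + y < 2 ^ i ∧ val x y = true := by
  induction i generalizing p with
  | zero =>
    simp only [sierpinskiStage, Set.mem_singleton_iff, pow_zero, Nat.lt_one_iff]
    constructor
    · rintro rfl
      exact ⟨0, 0, rfl, rfl, by decide⟩
    · rintro ⟨x, y, rfl, h, -⟩
      obtain ⟨rfl, rfl⟩ : x = 0 ∧ y = 0 := by omega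
      rfl
  | succ i ih =>
    have hchoose : ∀ x y, x + y < 2 ^ i → val (x + 2 ^ i) y = val x y ∧
        val x (y + 2 ^ i) = val x y := by
      intro x y hxy
      constructor
      · simp only [val]
        rw [show x + 2 ^ i + y = (x + y) + 2 ^ i by ring, choose_add_two_pow,
          Nat.choose_eq_zero_of_lt (by omega), if_pos (by omega), Nat.add_sub_cancel]
        simp
      · simp only [val]
        rw [show x + (y + 2 ^ i) = (x + y) + 2 ^ i by ring, choose_add_two_pow,
          if_neg (by omega), Bool.xor_false]
    simp only [sierpinskiStage, Set.mem_union, ih, Set.mem_ofPred_eq]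
    constructor
    · rintro (⟨x, y, rfl, h1, h2⟩ | ⟨m, ⟨x, y, rfl, h1, h2⟩, n, hn, rfl⟩)
      · exact ⟨x, y, rfl, by rw [pow_succ]; omega, h2⟩
      · rcases hn with rfl | rfl
        · exact ⟨x + 2 ^ i, y, by simp, by rw [pow_succ]; omega, by rw [(hchoose x y h1).1, h2]⟩
        · exact ⟨x, y + 2 ^ i, by simp, by rw [pow_succ]; omega, by rw [(hchoose x y h1).2, h2]⟩
    · rintro ⟨x, y, rfl, h1, h2⟩
      by_cases h : x + y < 2 ^ i
      · exact .inl ⟨x, y, rfl, h, h2⟩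
      · right
        rw [pow_succ] at h1
        by_cases hx : 2 ^ i ≤ x
        · obtain ⟨x, rfl⟩ := Nat.exists_eq_add_of_le' hx
          have hlt : x + y < 2 ^ i := by omega
          exact ⟨_, ⟨x, y, rfl, hlt, by rwa [(hchoose x y hlt).1] at h2⟩, (1, 0), by simp, by simp⟩
        · by_cases hy : 2 ^ i ≤ y
          · obtain ⟨y, rfl⟩ := Nat.exists_eq_add_of_le' hy
            have hlt : x + y < 2 ^ i := by omega
            exact ⟨_, ⟨x, y, rfl, hlt, by rwa [(hchoose x y hlt).2] at h2⟩, (0, 1), by simp, by simp⟩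
          · exfalso
            -- The central gap: here `m = x + y - 2 ^ i` is less than `x` because `y < 2 ^ i`, so
            -- `m.choose x` vanishes.
            obtain ⟨m, hm⟩ := Nat.exists_eq_add_of_le' (not_lt.1 h)
            simp only [val] at h2
            rw [hm, choose_add_two_pow, if_neg hx, Nat.choose_eq_zero_of_lt (by omega)] at h2
            simp at h2

theorem mem_sierpinski {p : ℤ × ℤ} : p ∈ sierpinski ↔
    ∃ x y : ℕ, p = ((x : ℤ), (y : ℤ)) ∧ val x y = true := by
  simp only [sierpinski, Set.mem_iUnion, mem_sierpinskiStage]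
  constructor
  · rintro ⟨i, x, y, h1, -, h2⟩
    exact ⟨x, y, h1, h2⟩
  · rintro ⟨x, y, h1, h2⟩
    exact ⟨x + y, x, y, h1, Nat.lt_two_pow_self, h2⟩

/-! ### Terminal supertiles and their labels. -/

theorem done_of_terminal {A : Supertile Glue Unit} (hA : system.Terminal A) {p : ℤ × ℤ}
    {t : Tile Glue Unit} (ht : A p = some t) {a : Action Glue Unit} (ha : a ∈ t.pending)
    (hon : a.IsOn) : t.Done a := by
  obtain ⟨rest, hp⟩ := Multiset.exists_cons_of_mem ha
  cases a with
  | glue d g q =>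
    obtain rfl : q = .on := hon
    exact fun hs => hA.2.2 _ (.glue_activate A p t d g rest ht hp hs)
  | label x q =>
    exact fun hs => hA.2.2 _ (.label A p t x q _ rest ht hp hs)

section Terminal

variable {o : ℤ × ℤ} {A : Supertile Glue Unit}

theorem Seeded.done_of_bond (h : Seeded o A) (hA : system.Terminal A) {x y : ℕ}
    {t : Tile Glue Unit} (ht : A (pos o x y) = some t) {d : Dir} {g : Glue}
    (hb : Bond A A (pos o x y) d g) {a : Action Glue Unit}
    (ha : a ∈ (kind x y).requests d g) : t.Done a := by
  rcases (h.evolved x y t ht).pending_or_done a ⟨d, g, hb, ha⟩ with hp | hd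
  · exact done_of_terminal hA ht hp (Kind.isOn_of_mem ha)
  · exact hd

theorem Seeded.on_of_bond (h : Seeded o A) (hA : system.Terminal A) {x y : ℕ} {d e : Dir}
    {g l : Glue} (hb : Bond A A (pos o x y) d g) (hl : (kind x y).glue e l = some .latent)
    (ha : .glue e l .on ∈ (kind x y).requests d g) :
    A.glueAt (pos o x y) e l = some .on := by
  obtain ⟨t, ht, -⟩ := glueAt_eq_some.1 hb.1
  rw [glueAt_of_eq ht]
  rcases (h.evolved x y t ht).glue_eq e l with h1 | h1
  · exact absurd (h1.trans hl) (h.done_of_bond hA ht hb ha)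
  · exact h1.2.1

theorem producible_of_finitelyProducible (h : system.FinitelyProducible A)
    (hne : A.support.Nonempty) : system.Producible A :=
  ⟨hne, fun _ => A, ⟨h, fun _ => .inl rfl⟩, fun _ => ⟨0, fun _ _ => rfl⟩⟩

theorem producible_single (k : Kind) : system.Producible (single k.tile) :=
  producible_of_finitelyProducible (finitelyProducible_single k) ⟨0, by simp [support, single]⟩

theorem Seeded.ne_none_of_output (h : Seeded o A) (hA : system.Terminal A) {x y : ℕ} {d : Dir}
    {g : Glue} (hk : (kind x y).input = some (d, g))
    (hg : A.glueAt (pos o x y + d.vec) d.opp g = some .on) : A (pos o x y) ≠ none := fun hq =>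
  hA.2.1 (single (kind x y).tile) (pos o x y) (producible_single _)
    (combinable_of_glueAt (.inr ⟨o, h⟩) hq hk hg)

/-- All glues that are on in the final state of the tile at `(x, y)`, on its eastern and northern
side, are on in `A`. -/
structure Output (o : ℤ × ℤ) (A : Supertile Glue Unit) (x y : ℕ) : Prop where
  ne_none : A (pos o x y) ≠ none
  east_x : y = 0 → A.glueAt (pos o x y) .east .x = some .on
  north_y : x = 0 → A.glueAt (pos o x y) .north .y = some .on
  east_w : y ≠ 0 → A.glueAt (pos o x y) .east (.w (val x y)) = some .on
  north_v : x ≠ 0 → ∀ e, A.glueAt (pos o x y) .north (.v (val x y) e) = some .on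

/-- Terminality forces the tile to be present, through its western neighbour, and both its southern
guesses to be on. The guess matching the value below meets a glue that is on. -/
theorem Seeded.bond_south (h : Seeded o A) (hA : system.Terminal A) {x y : ℕ}
    (hw : Output o A x (y + 1)) (hs : Output o A (x + 1) y) :
    Bond A A (pos o (x + 1) (y + 1)) .south (.v (val (x + 1) y) (val x (y + 1))) := by
  have hne : A (pos o (x + 1) (y + 1)) ≠ none := by
    refine h.ne_none_of_output hA (d := .west) (g := .w (val x (y + 1))) rfl ?_
    rw [pos_west]
    exact hw.east_w y.succ_ne_zero
  have hb := h.bond (x + 1) (y + 1) hne .west (.w (val x (y + 1))) rfl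
  refine ⟨h.on_of_bond hA hb ?_ ?_, ?_⟩
  · simp [kind, Kind.glue]
  · simp only [kind, Kind.requests, if_true]
    cases val (x + 1) y <;> simp
  · rw [pos_south]
    exact hs.north_v x.succ_ne_zero _

/-- Induction along antidiagonals: in a terminal supertile each exposed output has attracted its
tile, and each bond has had its requests executed. -/
theorem Seeded.output (h : Seeded o A) (hA : system.Terminal A) :
    ∀ n x y, x + y = n → Output o A x y := by
  intro n
  induction n with
  | zero =>
    intro x y hn
    obtain ⟨rfl, rfl⟩ : x = 0 ∧ y = 0 := by omega
    have hne : A (pos o 0 0) ≠ none := by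
      rw [pos_zero]
      exact h.seed
    obtain ⟨t, ht⟩ := Option.ne_none_iff_exists'.1 hne
    have hon : ∀ d g, Kind.seed.glue d g = some .on → A.glueAt (pos o 0 0) d g = some .on := by
      intro d g hg
      rw [glueAt_of_eq ht]
      rcases (h.evolved 0 0 t ht).glue_eq d g with h1 | h1
      · exact h1.trans hg
      · exact h1.2.1
    exact ⟨hne, fun _ => hon _ _ rfl, fun _ => hon _ _ rfl, fun h => absurd rfl h,
      fun h => absurd rfl h⟩
  | succ n ih =>
    rintro (_ | x) (_ | y) hn
    · omega
    · have hp := (ih 0 y (by omega)).north_y rfl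
      have hne : A (pos o 0 (y + 1)) ≠ none := by
        refine h.ne_none_of_output hA (d := .south) (g := .y) rfl ?_
        rw [pos_south]
        exact hp
      have hb := h.bond 0 (y + 1) hne .south .y rfl
      refine ⟨hne, fun h => absurd h y.succ_ne_zero, fun _ => ?_, fun _ => ?_,
        fun h => absurd rfl h⟩
      · exact h.on_of_bond hA hb rfl (by simp [kind, Kind.requests])
      · rw [val_zero_left]
        exact h.on_of_bond hA hb rfl (by simp [kind, Kind.requests])
    · have hp := (ih x 0 (by omega)).east_x rfl
      have hne : A (pos o (x + 1) 0) ≠ none := by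
        refine h.ne_none_of_output hA (d := .west) (g := .x) rfl ?_
        rw [pos_west]
        exact hp
      have hb := h.bond (x + 1) 0 hne .west .x rfl
      refine ⟨hne, fun _ => ?_, fun h => absurd h x.succ_ne_zero, fun h => absurd rfl h,
        fun _ e => ?_⟩
      · exact h.on_of_bond hA hb rfl (by simp [kind, Kind.requests])
      · rw [val_zero_right]
        exact h.on_of_bond hA hb rfl (by cases e <;> simp [kind, Kind.requests])
    · have hb := h.bond_south hA (ih x (y + 1) (by omega)) (ih (x + 1) y (by omega))
      refine ⟨ne_none_of_glueAt hb.1, fun h => absurd h y.succ_ne_zero,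
        fun h => absurd h x.succ_ne_zero, fun _ => ?_, fun _ e => ?_⟩
      · rw [val_succ_succ]
        exact h.on_of_bond hA hb rfl (by simp [kind, Kind.requests])
      · rw [val_succ_succ]
        exact h.on_of_bond hA hb rfl (by cases e <;> simp [kind, Kind.requests])

/-- On the axes the label starts on and the value is 1. Elsewhere only a southern bond can request
it, and by `val_eq` that bond carries the true southern value. -/
theorem Seeded.label_iff (h : Seeded o A) (hA : system.Terminal A) {x y : ℕ} {t : Tile Glue Unit}
    (ht : A (pos o x y) = some t) : t.label () = some .on ↔ val x y = true := by
  have hlab := (h.evolved x y t ht).label_eq ()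
  have haxis : (kind x y).label = .on → t.label () = some .on := by
    intro hk
    rcases hlab with h1 | h1
    · rw [h1, ← hk]
      rfl
    · exact h1.2.1
  rcases x with _ | x <;> rcases y with _ | y
  · simp [val_zero_left, haxis rfl]
  · simp [val_zero_left, haxis rfl]
  · simp [val_zero_right, haxis rfl]
  · have hb := h.bond_south hA (h.output hA _ x (y + 1) rfl) (h.output hA _ (x + 1) y rfl)
    have hlat : (kind (x + 1) (y + 1)).tile.label () = some .latent := rfl
    constructor
    · intro hon
      rcases hlab with h1 | ⟨-, -, d, g, hb', hr⟩
      · rw [h1, hlat] at hon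
        simp at hon
      · rw [Kind.mem_trans] at hr
        simp only [kind] at hr
        cases d with
        | east => simp [Kind.requests_east] at hr
        | north => simp [Kind.requests_north] at hr
        | west =>
          rcases g with _ | _ | c | ⟨a, c⟩ <;>
            simp only [Kind.requests, List.not_mem_nil] at hr
          split_ifs at hr <;> simp at hr
        | south =>
          rcases g with _ | _ | c | ⟨a, c⟩ <;>
            simp only [Kind.requests, List.not_mem_nil] at hr
          have h2 := hb'.2
          rw [pos_south] at h2
          have ha := (h.val_eq y (x + 1) a).1 _ h2
          subst ha
          rw [val_succ_succ]
          split_ifs at hr with h3 h4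
          · exact h4
          · simp at hr
          · simp at hr
    · intro hv
      rw [val_succ_succ] at hv
      rcases hlab with h1 | h1
      · refine absurd (h1.trans hlat) (h.done_of_bond hA ht hb (a := .label () .on) ?_)
        simp only [kind, Kind.requests, hv, if_true]
        simp
      · exact h1.2.1

theorem Seeded.painted_eq (h : Seeded o A) (hA : system.Terminal A) :
    System.painted Set.univ A = (fun p => p + o) '' sierpinski := by
  ext p
  simp only [System.painted, Set.mem_ofPred_eq, Set.mem_univ, true_and, Set.mem_image,
    mem_sierpinski]
  constructor
  · rintro ⟨t, ht, ⟨⟩, hl⟩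
    obtain ⟨x, y, rfl⟩ := h.exists_pos p (by simp [ht])
    exact ⟨_, ⟨x, y, rfl, (h.label_iff hA ht).1 hl⟩, by ext <;> simp [pos, add_comm]⟩
  · rintro ⟨_, ⟨x, y, rfl, hv⟩, rfl⟩
    have hp : ((x : ℤ), (y : ℤ)) + o = pos o x y := by ext <;> simp [pos, add_comm]
    obtain ⟨t, ht⟩ := Option.ne_none_iff_exists'.1 (h.output hA _ x y rfl).ne_none
    exact ⟨t, by rw [hp, ht], (), (h.label_iff hA ht).2 hv⟩

end Terminal

theorem Kind.exists_kind_eq (k : Kind) : ∃ x y, kind x y = k := by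
  rcases k with _ | _ | _ | _ | _
  · exact ⟨0, 0, rfl⟩
  · exact ⟨1, 0, rfl⟩
  · exact ⟨0, 1, rfl⟩
  -- The value 0 occurs at `(1, 1)`, so its eastern neighbour is an inner tile with western value 0.
  · exact ⟨2, 1, by decide⟩
  · exact ⟨1, 1, by decide⟩

/-- The kind occurs at some `(x, y)`, and the stage just before that position is filled is
producible. Translated so that the missing position falls on `q`, it combines with the lone tile. -/
theorem not_terminal_singleAt {q : ℤ × ℤ} {k : Kind} (hk : k ≠ .seed) :
    ¬ system.Terminal (singleAt q k) := by
  intro hT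
  obtain ⟨x, y, rfl⟩ := k.exists_kind_eq
  obtain ⟨d, g, hin⟩ : ∃ d g, (kind x y).input = some (d, g) := by
    cases hkxy : kind x y <;> simp [hkxy, Kind.input] at hk ⊢
  obtain ⟨n, hn⟩ : ∃ n, Nat.pair x y = n + 1 := by
    refine Nat.exists_eq_succ_of_ne_zero fun h0 => hk ?_
    have : Nat.pair x y = Nat.pair 0 0 := h0
    obtain ⟨rfl, rfl⟩ := Nat.pair_eq_pair.1 this
    rfl
  have hfp := finitelyProducible_stage n
  rw [← hn] at hfp
  have hg := glueAt_stage_input hin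
  have hprod := producible_of_finitelyProducible hfp ⟨_, ne_none_of_glueAt hg⟩
  refine hT.2.1 _ (q - pos 0 x y) hprod (combinable_symm (fun _ => rfl)
    (combinable_of_glueAt ((regular_of_finitelyProducible hfp).translate _) ?_ hin ?_))
  · simp only [Supertile.translate, sub_sub_cancel]
    exact stage_self x y
  · change (stage (Nat.pair x y)).glueAt (q + d.vec - (q - pos 0 x y)) d.opp g = some .on
    rw [show q + d.vec - (q - pos 0 x y) = pos 0 x y + d.vec by abel]
    exact hg

theorem weaklySelfAssembles : system.WeaklySelfAssembles sierpinski := by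
  refine ⟨⟨full, terminal_full⟩, Set.univ, fun A hA => ?_⟩
  rcases regular_of_producible hA.1 with ⟨q, k, hk, rfl⟩ | ⟨o, ho⟩
  · exact absurd hA (not_terminal_singleAt hk)
  · exact ⟨o, ho.painted_eq hA⟩

/-! ### Tile complexity, signal complexity and absence of deactivation. -/

theorem Kind.glue_injective : Function.Injective Kind.glue := by
  intro k l h
  have : ∀ k l : Kind, (∀ d g, k.glue d g = l.glue d g) → k = l := by decide
  exact this k l fun d g => by rw [h]

theorem tileComplexity_eq : system.tileComplexity = 5 := by
  have hinj : Function.Injective fun k : Kind => single k.tile := by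
    intro k l h
    have h0 := congrFun h 0
    simp only [single, if_true, Option.some.injEq] at h0
    exact Kind.glue_injective (congrArg Tile.glue h0)
  change (Set.range fun k : Kind => single k.tile).encard = 5
  rw [← Set.image_univ, hinj.encard_image, Set.encard_univ, ENat.card_eq_coe_fintype_card]
  rfl

theorem encard_glue (k : Kind) (d : Dir) :
    {g | k.glue d g ≠ none}.encard = (Finset.univ.filter fun g => k.glue d g ≠ none).card := by
  rw [← Set.encard_coe_eq_coe_finsetCard]
  simp

theorem signalComplexity_eq : system.signalComplexity = 4 := by
  apply le_antisymm
  · refine iSup₂_le fun A hA => iSup₂_le fun p d => ?_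
    obtain ⟨k, rfl⟩ := hA
    have hsub : {g | (single k.tile).glueAt p d g ≠ none} ⊆ {g | k.glue d g ≠ none} := by
      intro g hg hn
      apply hg
      by_cases hp : p = 0
      · simp [glueAt, single, hp, Kind.tile, hn]
      · simp [glueAt, single, hp]
    refine (Set.encard_le_encard hsub).trans ?_
    rw [encard_glue]
    have : ∀ k d, (Finset.univ.filter fun g => Kind.glue k d g ≠ none).card ≤ 4 := by decide
    exact_mod_cast this k d
  -- The maximum is attained on the northern face of an inner tile, which has all four glues `v a
  -- b`.
  · have h : {g | (single (Kind.inner true).tile).glueAt 0 .north g ≠ none}.encard = 4 := by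
      have : {g | (single (Kind.inner true).tile).glueAt 0 .north g ≠ none} =
          {g | (Kind.inner true).glue .north g ≠ none} := by
        simp [glueAt, single, Kind.tile]
      rw [this, encard_glue]
      rfl
    rw [← h]
    exact le_iSup₂_of_le (single (Kind.inner true).tile) ⟨_, rfl⟩
      (le_iSup₂_of_le (0 : ℤ × ℤ) Dir.north le_rfl)

theorem noGlueDeactivation : system.NoGlueDeactivation := by
  rintro _ ⟨k, rfl⟩ p t ht d g d' g' hmem
  simp only [single] at ht
  split_ifs at ht
  obtain rfl : k.tile = t := by simpa using ht
  have : Target.off = Target.on := Kind.isOn_of_mem (k := k) hmem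
  simp at this

end Sierpinski
end STAM

theorem theorem6 :
    ∃ (Γ Λ : Type) (_ : Fintype Γ) (_ : DecidableEq Γ) (_ : DecidableEq Λ)
      (S : STAM.System Γ Λ),
      S.HasSingletonTiles ∧ S.tileComplexity = 5 ∧ S.signalComplexity = 4 ∧
      S.temperature = 1 ∧ (∀ g, S.strength g = 1) ∧ S.NoGlueDeactivation ∧
      S.WeaklySelfAssembles STAM.sierpinski := by
  refine ⟨STAM.Sierpinski.Glue, Unit, inferInstance, inferInstance, inferInstance,
    STAM.Sierpinski.system, ?_, STAM.Sierpinski.tileComplexity_eq,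
    STAM.Sierpinski.signalComplexity_eq, rfl, fun _ => rfl, STAM.Sierpinski.noGlueDeactivation,
    STAM.Sierpinski.weaklySelfAssembles⟩
  rintro _ ⟨k, rfl⟩
  exact ⟨k.tile, rfl⟩
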